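/- Let $a>0$, $\Omega=(0,a)\times(0,a)$ and $m\in\mathbb N$. For $l=1,\dots,m$ let $f_l:\Omega\times[0,\infty)\to\mathbb R$, $f_l=f_l(z,s)$, be Lipschitz continuous in $s$ (with a constant independent of $z$), uniformly continuous in $z\in\Omega$ for each $s$, nondecreasing in $s$, and such that $f_l(z,0)\ge 0$ (this includes the case $f_l(z,0)\equiv0$ and the case of nonnegative $f_l=f_l(z)$ independent of $s$); put $F_l(z,s)=\int_0^s f_l(z,t)\,dt$. Let $\phi_1,\dots,\phi_m:\partial\Omega\to[0,\infty)$ satisfy $\phi_l\phi_p=0$ for $l\ne p$, and let $$S=\{(v_1,\dots,v_m)\in W^{1,2}(\Omega)^m:\ v_l\ge0,\ v_l\,v_p=0\text{ a.e. for }l\neq p,\ v_l=\phi_l\text{ on }\partial\Omega\text{ in the sense of traces}\}.$$ Let $(u_1,\dots,u_m)\in S$ be a minimizer over $S$ of $$E(v_1,\dots,v_m)=\int_\Omega\sum_{l=1}^m\Big(\tfrac12|\nabla v_l|^2+F_l(z,v_l)\Big)\,dz,$$ and suppose that, for every $l$, $u_l\in C^2(\Omega)\cap C(\overline\Omega)$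 and $u_l=\phi_l$ pointwise on $\partial\Omega$. For a positive integer $N$ let $h=a/N$, $\Omega_h=\{(ih,jh):0\le i,j\le N\}$, $\Omega_h^o=\{(ih,jh):1\le i,j\le N-1\}$ and $\partial\Omega_h=\Omega_h\setminus\Omega_h^o$. Let functions $u_h^1,\dots,u_h^m:\Omega_h\to\mathbb R$ solve the finite difference scheme $$u_h^l(z)=\max\Big(-\tfrac{h^2}{4}f_l(z,u_h^l(z))+\overline u_h^l(z)-\sum_{p\ne l}\overline u_h^p(z),\ 0\Big)\quad(z\in\Omega_h^o),\qquad u_h^l(z)=\phi_l(z)\quad(z\in\partial\Omega_h),$$ for $l=1,\dots,m$, where $\overline u_h^l(z)$ is the average of $u_h^l$ over the four mesh points nearest to $z$. Then $u_h^l\to u_l$ uniformly on the grid as $h\to0$, for every $l=1,\dots,m$: for every $\varepsilon>0$ there is $N_0$ such that for all $N\ge N_0$ and every solution $(u_h^1,\dots,u_h^m)$ of the scheme with $h=a/N$, $$\max_{z\in\Omega_h}|u_h^l(z)-u_l(z)|<\varepsilon\qquad(l=1,\dots,m).$$ -/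

import Mathlib

open scoped ContDiff

noncomputable section

namespace Segregation

/-- The domain `Ω = (0,a) × (0,a)`. -/
def openSquare (a : ℝ) : Set (ℝ × ℝ) := Set.Ioo 0 a ×ˢ Set.Ioo 0 a

/-- The closure of `Ω`. -/
def closedSquare (a : ℝ) : Set (ℝ × ℝ) := Set.Icc 0 a ×ˢ Set.Icc 0 a

/-- The boundary `∂Ω`. -/
def squareBoundary (a : ℝ) : Set (ℝ × ℝ) := closedSquare a \ openSquare a

/-- Lebesgue measure on `Ω`. -/
def squareMeasure (a : ℝ) : MeasureTheory.Measure (ℝ × ℝ) :=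
  MeasureTheory.volume.restrict (openSquare a)

/-- The classical partial derivative in the first variable. -/
def partialX (w : ℝ × ℝ → ℝ) (z : ℝ × ℝ) : ℝ := fderiv ℝ w z (1, 0)

/-- The classical partial derivative in the second variable. -/
def partialY (w : ℝ × ℝ → ℝ) (z : ℝ × ℝ) : ℝ := fderiv ℝ w z (0, 1)

/-- `v ∈ W^{1,2}(Ω)` with weak gradient `(gx, gy)`. -/
structure HasWeakGradient (a : ℝ) (v gx gy : ℝ × ℝ → ℝ) : Prop where
  memLp : MeasureTheory.MemLp v 2 (squareMeasure a)
  memLp_x : MeasureTheory.MemLp gx 2 (squareMeasure a)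
  memLp_y : MeasureTheory.MemLp gy 2 (squareMeasure a)
  weak_x : ∀ η : ℝ × ℝ → ℝ, ContDiff ℝ ∞ η → HasCompactSupport η →
    tsupport η ⊆ openSquare a →
    ∫ z, v z * partialX η z ∂(squareMeasure a) = -∫ z, gx z * η z ∂(squareMeasure a)
  weak_y : ∀ η : ℝ × ℝ → ℝ, ContDiff ℝ ∞ η → HasCompactSupport η →
    tsupport η ⊆ openSquare a →
    ∫ z, v z * partialY η z ∂(squareMeasure a) = -∫ z, gy z * η z ∂(squareMeasure a)

/-- The four sides of the square, parametrized by arc length `t ∈ (0,a)`. -/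
def edge (a : ℝ) : Fin 4 → ℝ → ℝ × ℝ :=
  ![fun t => (t, 0), fun t => (t, a), fun t => (0, t), fun t => (a, t)]

/-- `v ∈ W^{1,2}(Ω)` has trace `φ` on `∂Ω`: some sequence of `C¹` functions on the plane
converges to `v` in `W^{1,2}(Ω)` while its restrictions to `∂Ω` converge to `φ` in `L²(∂Ω)`. -/
def HasTrace (a : ℝ) (v φ : ℝ × ℝ → ℝ) : Prop :=
  ∃ gx gy : ℝ × ℝ → ℝ, HasWeakGradient a v gx gy ∧
    ∃ w : ℕ → ℝ × ℝ → ℝ, (∀ k, ContDiff ℝ 1 (w k)) ∧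
      Filter.Tendsto
        (fun k => MeasureTheory.eLpNorm (fun z => w k z - v z) 2 (squareMeasure a))
        Filter.atTop (nhds 0) ∧
      Filter.Tendsto
        (fun k => MeasureTheory.eLpNorm (fun z => partialX (w k) z - gx z) 2 (squareMeasure a))
        Filter.atTop (nhds 0) ∧
      Filter.Tendsto
        (fun k => MeasureTheory.eLpNorm (fun z => partialY (w k) z - gy z) 2 (squareMeasure a))
        Filter.atTop (nhds 0) ∧
      ∀ e : Fin 4, Filter.Tendsto
        (fun k => MeasureTheory.eLpNorm (fun t => w k (edge a e t) - φ (edge a e t)) 2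
          (MeasureTheory.volume.restrict (Set.Ioo 0 a)))
        Filter.atTop (nhds 0)

/-- The class `S` of segregated nonnegative states in `(W^{1,2}(Ω))^m` with boundary values `φ`. -/
structure IsAdmissible {m : ℕ} (a : ℝ) (φ v : Fin m → ℝ × ℝ → ℝ) : Prop where
  sobolev : ∀ l, ∃ gx gy, HasWeakGradient a (v l) gx gy
  nonneg : ∀ l, ∀ᵐ z ∂(squareMeasure a), 0 ≤ v l z
  segregated : ∀ l p, l ≠ p → ∀ᵐ z ∂(squareMeasure a), v l z * v p z = 0
  trace : ∀ l, HasTrace a (v l) (φ l)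

/-- The energy `∫_Ω ∑ₗ (½|∇vₗ|² + Fₗ(z, vₗ))`, where `Fₗ(z, s) = ∫₀ˢ fₗ(z, t) dt` and
`(gx l, gy l)` is the weak gradient of `v l`. -/
def energy {m : ℕ} (a : ℝ) (f : Fin m → ℝ × ℝ → ℝ → ℝ) (v gx gy : Fin m → ℝ × ℝ → ℝ) : ℝ :=
  ∫ z, ∑ l, ((1 / 2 : ℝ) * (gx l z ^ 2 + gy l z ^ 2) + ∫ t in (0 : ℝ)..v l z, f l z t)
    ∂(squareMeasure a)

/-- `u` minimizes the energy over `S`. (Weak gradients are unique almost everywhere, so the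
energies below depend only on `u` and `v`.) -/
def IsMinimizer {m : ℕ} (a : ℝ) (f : Fin m → ℝ × ℝ → ℝ → ℝ) (φ u : Fin m → ℝ × ℝ → ℝ) : Prop :=
  IsAdmissible a φ u ∧
    ∀ v : Fin m → ℝ × ℝ → ℝ, IsAdmissible a φ v →
      ∀ ux uy vx vy : Fin m → ℝ × ℝ → ℝ,
        (∀ l, HasWeakGradient a (u l) (ux l) (uy l)) →
        (∀ l, HasWeakGradient a (v l) (vx l) (vy l)) →
        energy a f u ux uy ≤ energy a f v vx vy

/-- Internal dynamics `fₗ(z, s)`, `z ∈ Ω`, `s ≥ 0`: Lipschitz continuous and nondecreasing in `s`,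
uniformly continuous in `z`, and nonnegative at `s = 0`. This covers both the case
`fₗ(z, 0) ≡ 0` and the case of nonnegative `fₗ` that do not depend on `s`. -/
structure IsInternalDynamics (a : ℝ) (f : ℝ × ℝ → ℝ → ℝ) : Prop where
  lipschitz : ∃ K : ℝ, ∀ z ∈ openSquare a, ∀ s t : ℝ, 0 ≤ s → 0 ≤ t →
    |f z s - f z t| ≤ K * |s - t|
  uniformContinuousOn : ∀ s : ℝ, 0 ≤ s → UniformContinuousOn (fun z => f z s) (openSquare a)
  monotone : ∀ z ∈ openSquare a, ∀ s t : ℝ, 0 ≤ s → s ≤ t → f z s ≤ f z t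
  nonneg_zero : ∀ z ∈ openSquare a, 0 ≤ f z 0

/-- The mesh point `(ih, jh)`, where `h = a / N`; the mesh `Ω_h` consists of those with
`0 ≤ i, j ≤ N`. -/
def gridPoint (a : ℝ) (N : ℕ) (i j : ℤ) : ℝ × ℝ := (i * (a / N), j * (a / N))

/-- The average of a mesh function over the four neighbours of the mesh point `(ih, jh)`. -/
def neighbourAverage (V : ℤ → ℤ → ℝ) (i j : ℤ) : ℝ :=
  (1 / 4 : ℝ) * (V (i - 1) j + V (i + 1) j + V i (j - 1) + V i (j + 1))

/-- `U l i j` is the value at the mesh point `(ih, jh)`, `h = a / N`, `0 ≤ i, j ≤ N`, of the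
`l`-th component of a solution to the finite difference scheme. -/
structure IsSchemeSolution {m : ℕ} (a : ℝ) (N : ℕ) (f : Fin m → ℝ × ℝ → ℝ → ℝ)
    (φ : Fin m → ℝ × ℝ → ℝ) (U : Fin m → ℤ → ℤ → ℝ) : Prop where
  interior : ∀ l, ∀ i j : ℤ, 1 ≤ i → i ≤ N - 1 → 1 ≤ j → j ≤ N - 1 →
    U l i j = max (-(f l (gridPoint a N i j) (U l i j)) * (a / N) ^ 2 / 4
      + neighbourAverage (U l) i j
      - ∑ p ∈ Finset.univ.erase l, neighbourAverage (U p) i j) 0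
  boundary : ∀ l, ∀ i j : ℤ, 0 ≤ i → i ≤ N → 0 ≤ j → j ≤ N →
    (i = 0 ∨ i = N ∨ j = 0 ∨ j = N) → U l i j = φ l (gridPoint a N i j)

end Segregation

end

/-! The tuple is studied through the differences û_l = u_l - ∑_{p≠l} u_p. A segregated tuple is
recovered from them as u_l = max(û_l, 0), so it is enough to compare hats. The mesh solution and the
minimizer obey the same relations, exactly and up to a consistency error respectively: the discrete
Laplacian of the l-th hat is at most (h²/4) f_l(u_l), with equality where u_l > 0. For the scheme
this is algebra (`IsSchemeSolution.neighbourAverage_meshHat_le`,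
`IsSchemeSolution.neighbourAverage_meshHat_of_pos`). For the minimizer, perturbing inside {u_l > 0}
gives Δu_l = f_l there (`IsMinimizer.lap_eq_of_pos`); as u_l is C², Δu_l ≤ f_l follows everywhere
(`IsMinimizer.lap_le`), and `exists_abs_fivePoint_sub_le` carries both to the mesh.

The comparison is `abs_hat_sub_le`. Where the gap between the two hats is largest over all mesh
points and all components, the component can be changed so that the larger hat belongs to a positive
entry. There the equation for one tuple, the inequality for the other and the monotonicity of f_l
make the gap subharmonic up to the error, and a small multiple of |z|² absorbs the error. The gap is
thus controlled by its values where the relations are not available.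

Those places are a strip along ∂Ω, since u_l is C² only in the interior. In the strip, barriers show
that mesh solutions take their boundary values uniformly in N (`exists_abs_sub_le_near_boundary`).
Hence the strip is fixed before the mesh size. Only the scheme itself is used, so the estimate
covers every solution and needs no uniqueness. -/

namespace Segregation

/-! ### Segregated vectors -/

section Hat

variable {m : ℕ}

/-- `v̂ₗ = vₗ - ∑_{p ≠ l} vₚ`. -/
noncomputable def hat (v : Fin m → ℝ) (l : Fin m) : ℝ := v l - ∑ p ∈ Finset.univ.erase l, v p

/-- Nonnegative vectors with at most one nonzero entry. -/
structure IsSegregated (v : Fin m → ℝ) : Prop where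
  nonneg : ∀ l, 0 ≤ v l
  segregated : ∀ l p, l ≠ p → v l * v p = 0

lemma IsSegregated.eq_zero_of_pos {v : Fin m → ℝ} (hv : IsSegregated v) {l p : Fin m}
    (hl : 0 < v l) (hp : p ≠ l) : v p = 0 := by
  have := hv.segregated l p hp.symm
  rcases mul_eq_zero.1 this with h | h
  · linarith
  · exact h

lemma IsSegregated.hat_of_pos {v : Fin m → ℝ} (hv : IsSegregated v) {l : Fin m} (hl : 0 < v l) :
    hat v l = v l := by
  unfold hat
  rw [Finset.sum_eq_zero, sub_zero]
  intro p hp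
  exact hv.eq_zero_of_pos hl (Finset.ne_of_mem_erase hp)

lemma hat_le {v : Fin m → ℝ} (hv : ∀ l, 0 ≤ v l) (l : Fin m) : hat v l ≤ v l := by
  unfold hat
  have := Finset.sum_nonneg (s := Finset.univ.erase l) (fun p _ => hv p)
  linarith

lemma hat_le_neg {v : Fin m → ℝ} (hv : ∀ l, 0 ≤ v l) {l p : Fin m} (hlp : l ≠ p) :
    hat v l ≤ v l - v p := by
  unfold hat
  have := Finset.single_le_sum (s := Finset.univ.erase l) (f := v) (fun p _ => hv p)
    (Finset.mem_erase.2 ⟨hlp.symm, Finset.mem_univ p⟩)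
  linarith

/-- Each hat is bounded by the difference of the two entries, and the two bounds add up to zero. -/
lemma hat_le_neg_hat {v : Fin m → ℝ} (hv : ∀ l, 0 ≤ v l) {l p : Fin m} (hlp : l ≠ p) :
    hat v l ≤ -hat v p := by
  have h1 := hat_le_neg hv hlp
  have h2 := hat_le_neg hv hlp.symm
  linarith

lemma IsSegregated.max_hat {v : Fin m → ℝ} (hv : IsSegregated v) (l : Fin m) :
    max (hat v l) 0 = v l := by
  rcases (hv.nonneg l).lt_or_eq with h | h
  · rw [hv.hat_of_pos h, max_eq_left h.le]
  · rw [← h]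
    exact max_eq_right ((hat_le hv.nonneg l).trans h.ge)

lemma IsSegregated.abs_sub_le {v w : Fin m → ℝ} (hv : IsSegregated v) (hw : IsSegregated w)
    (l : Fin m) : |v l - w l| ≤ |hat v l - hat w l| := by
  rw [← hv.max_hat l, ← hw.max_hat l]
  exact abs_max_sub_max_le_abs _ _ _

/-- The change of component in the comparison. If `v l = 0`, then `hat w l < 0` forces one positive
entry `w p`, and `hat w p = -hat w l`, while `hat v l ≤ -hat v p` always holds. So passing to `p`
with the roles of `v` and `w` exchanged does not shrink the gap. -/
lemma IsSegregated.exists_pos_of_hat_lt {v w : Fin m → ℝ} (hv : IsSegregated v)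
    (hw : IsSegregated w) {l : Fin m} (h : hat w l < hat v l) :
    (0 < v l) ∨ ∃ p, 0 < w p ∧ hat v l - hat w l ≤ hat w p - hat v p := by
  rcases (hv.nonneg l).lt_or_eq with hl | hl
  · exact Or.inl hl
  right
  have hneg : hat w l < 0 := h.trans_le ((hat_le hv.nonneg l).trans hl.ge)
  have hwl : w l = 0 := by rw [← hw.max_hat l, max_eq_right hneg.le]
  have hS : 0 < ∑ p ∈ Finset.univ.erase l, w p := by
    unfold hat at hneg; linarith
  obtain ⟨p, hp, hwp⟩ := Finset.exists_lt_of_sum_lt (s := Finset.univ.erase l)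
    (f := fun _ => (0 : ℝ)) (g := w) (by simpa using hS)
  have hpl := Finset.ne_of_mem_erase hp
  refine ⟨p, hwp, ?_⟩
  have e1 : hat w l = - w p := by
    unfold hat
    rw [hwl, Finset.sum_eq_single_of_mem p hp]
    · ring
    · intro q _ hq
      exact hw.eq_zero_of_pos hwp hq
  rw [e1, hw.hat_of_pos hwp]
  have := hat_le_neg_hat hv.nonneg hpl.symm
  linarith

end Hat

/-! ### The discrete maximum principle -/

lemma neighbourAverage_add (V W : ℤ → ℤ → ℝ) (i j : ℤ) :
    neighbourAverage (fun i j => V i j + W i j) i j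
      = neighbourAverage V i j + neighbourAverage W i j := by
  unfold neighbourAverage; ring

lemma neighbourAverage_sub (V W : ℤ → ℤ → ℝ) (i j : ℤ) :
    neighbourAverage (fun i j => V i j - W i j) i j
      = neighbourAverage V i j - neighbourAverage W i j := by
  unfold neighbourAverage; ring

lemma neighbourAverage_const_mul (c : ℝ) (V : ℤ → ℤ → ℝ) (i j : ℤ) :
    neighbourAverage (fun i j => c * V i j) i j = c * neighbourAverage V i j := by
  unfold neighbourAverage; ring

lemma neighbourAverage_neg (V : ℤ → ℤ → ℝ) (i j : ℤ) :
    neighbourAverage (fun i j => -V i j) i j = -neighbourAverage V i j := by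
  unfold neighbourAverage; ring

lemma neighbourAverage_hat {m : ℕ} (V : Fin m → ℤ → ℤ → ℝ) (l : Fin m) (i j : ℤ) :
    neighbourAverage (fun i j => hat (fun l => V l i j) l) i j
      = neighbourAverage (V l) i j - ∑ p ∈ Finset.univ.erase l, neighbourAverage (V p) i j := by
  unfold neighbourAverage hat
  rw [← Finset.mul_sum]
  simp only [Finset.sum_add_distrib]
  ring

lemma neighbourAverage_le {N : ℕ} {V W : ℤ → ℤ → ℝ}
    (h : ∀ i j : ℤ, 0 ≤ i → i ≤ N → 0 ≤ j → j ≤ N → V i j ≤ W i j) {i j : ℤ}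
    (hi : 1 ≤ i) (hi' : i ≤ N - 1) (hj : 1 ≤ j) (hj' : j ≤ N - 1) :
    neighbourAverage V i j ≤ neighbourAverage W i j := by
  unfold neighbourAverage
  have h1 := h (i - 1) j (by omega) (by omega) (by omega) (by omega)
  have h2 := h (i + 1) j (by omega) (by omega) (by omega) (by omega)
  have h3 := h i (j - 1) (by omega) (by omega) (by omega) (by omega)
  have h4 := h i (j + 1) (by omega) (by omega) (by omega) (by omega)
  linarith

/-- Maximum principle for finite families of mesh functions: at an interior mesh point where the
level `B` is exceeded, every value is less than the neighbour average of some member. -/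
lemma le_of_lt_neighbourAverage {ι : Type*} [Finite ι] {N : ℕ} {W : ι → ℤ → ℤ → ℝ} {B : ℝ}
    (hbd : ∀ l, ∀ i j : ℤ, 0 ≤ i → i ≤ N → 0 ≤ j → j ≤ N →
      (i = 0 ∨ i = N ∨ j = 0 ∨ j = N) → W l i j ≤ B)
    (hin : ∀ l, ∀ i j : ℤ, 1 ≤ i → i ≤ N - 1 → 1 ≤ j → j ≤ N - 1 → B < W l i j →
      ∃ l', W l i j < neighbourAverage (W l') i j)
    (l : ι) (i j : ℤ) (hi : 0 ≤ i) (hi' : i ≤ N) (hj : 0 ≤ j) (hj' : j ≤ N) : W l i j ≤ B := by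
  classical
  cases nonempty_fintype ι
  set s : Finset (ι × ℤ × ℤ) :=
    Finset.univ ×ˢ (Finset.Icc (0 : ℤ) N ×ˢ Finset.Icc (0 : ℤ) N) with hs
  -- The maximum runs over members and mesh points jointly, so it also bounds the neighbour average
  -- of a different member.
  obtain ⟨⟨l₀, i₀, j₀⟩, h₀, hmax⟩ := s.exists_max_image (fun q => W q.1 q.2.1 q.2.2)
    ⟨(l, i, j), by simp [*]⟩
  have hmax' : ∀ l, ∀ i j : ℤ, 0 ≤ i → i ≤ N → 0 ≤ j → j ≤ N → W l i j ≤ W l₀ i₀ j₀ :=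
    fun l i j h1 h2 h3 h4 => hmax (l, i, j) (by simp [*])
  refine (hmax' l i j hi hi' hj hj').trans ?_
  simp only [hs, Finset.mem_product, Finset.mem_univ, Finset.mem_Icc, true_and] at h₀
  obtain ⟨⟨h1, h2⟩, h3, h4⟩ := h₀
  by_cases hb : i₀ = 0 ∨ i₀ = N ∨ j₀ = 0 ∨ j₀ = N
  · exact hbd l₀ i₀ j₀ h1 h2 h3 h4 hb
  by_contra hlt
  push Not at hlt hb
  have k1 : 1 ≤ i₀ := by omega
  have k2 : i₀ ≤ N - 1 := by omega
  have k3 : 1 ≤ j₀ := by omega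
  have k4 : j₀ ≤ N - 1 := by omega
  obtain ⟨l', hl'⟩ := hin l₀ i₀ j₀ k1 k2 k3 k4 hlt
  have := neighbourAverage_le (V := W l') (W := fun _ _ => W l₀ i₀ j₀)
    (fun i j => hmax' l' i j) k1 k2 k3 k4
  have e : neighbourAverage (fun _ _ => W l₀ i₀ j₀) i₀ j₀ = W l₀ i₀ j₀ := by
    unfold neighbourAverage; ring
  linarith

/-- Comparison of two segregated families that satisfy the discrete system up to an error `e`
away from a set of mesh points where they are known to be close. -/
lemma abs_hat_sub_le {m N : ℕ} {V W : Fin m → ℤ → ℤ → ℝ} {F : Fin m → ℤ → ℤ → ℝ → ℝ}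
    {β : ℤ → ℤ → ℝ} {I : ℤ → ℤ → Prop} {e d B : ℝ}
    (hV : ∀ i j : ℤ, 0 ≤ i → i ≤ N → 0 ≤ j → j ≤ N → IsSegregated fun l => V l i j)
    (hW : ∀ i j : ℤ, 0 ≤ i → i ≤ N → 0 ≤ j → j ≤ N → IsSegregated fun l => W l i j)
    (hI : ∀ i j, I i j → 1 ≤ i ∧ i ≤ N - 1 ∧ 1 ≤ j ∧ j ≤ N - 1)
    (hF : ∀ l i j, I i j → MonotoneOn (F l i j) (Set.Ici 0))
    (hVle : ∀ l i j, I i j → neighbourAverage (fun i j => hat (fun l => V l i j) l) i j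
      - hat (fun l => V l i j) l ≤ F l i j (V l i j) + e)
    (hVge : ∀ l i j, I i j → 0 < V l i j → F l i j (V l i j) - e ≤
      neighbourAverage (fun i j => hat (fun l => V l i j) l) i j - hat (fun l => V l i j) l)
    (hWle : ∀ l i j, I i j → neighbourAverage (fun i j => hat (fun l => W l i j) l) i j
      - hat (fun l => W l i j) l ≤ F l i j (W l i j) + e)
    (hWge : ∀ l i j, I i j → 0 < W l i j → F l i j (W l i j) - e ≤
      neighbourAverage (fun i j => hat (fun l => W l i j) l) i j - hat (fun l => W l i j) l)
    (hβ : ∀ i j, I i j → 2 * e < neighbourAverage β i j - β i j)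
    (hβ0 : ∀ i j : ℤ, 0 ≤ i → i ≤ N → 0 ≤ j → j ≤ N → 0 ≤ β i j ∧ β i j ≤ d) (hB : 0 ≤ B)
    (hnear : ∀ l, ∀ i j : ℤ, 0 ≤ i → i ≤ N → 0 ≤ j → j ≤ N → ¬ I i j →
      |hat (fun l => V l i j) l - hat (fun l => W l i j) l| ≤ B)
    (l : Fin m) (i j : ℤ) (hi : 0 ≤ i) (hi' : i ≤ N) (hj : 0 ≤ j) (hj' : j ≤ N) :
    |hat (fun l => V l i j) l - hat (fun l => W l i j) l| ≤ B + d := by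
  set D : Fin m → ℤ → ℤ → ℝ := fun l i j =>
    |hat (fun l => V l i j) l - hat (fun l => W l i j) l| + β i j with hD
  -- Subtracting the upper bound for `W` from the lower bound for `V` and using monotonicity of `F`
  -- leaves a defect of at most `2 * e`, which `β` beats strictly. The statement is generic in `V`
  -- and `W` because it is also applied with the two interchanged.
  have key : ∀ (V W : Fin m → ℤ → ℤ → ℝ) (l : Fin m) (i j : ℤ),
      (IsSegregated fun l => V l i j) → (IsSegregated fun l => W l i j) → I i j →
      (F l i j (V l i j) - e ≤
        neighbourAverage (fun i j => hat (fun l => V l i j) l) i j - hat (fun l => V l i j) l) →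
      (neighbourAverage (fun i j => hat (fun l => W l i j) l) i j
        - hat (fun l => W l i j) l ≤ F l i j (W l i j) + e) →
      0 < V l i j → hat (fun l => W l i j) l < hat (fun l => V l i j) l →
      hat (fun l => V l i j) l - hat (fun l => W l i j) l + β i j <
        neighbourAverage (fun i j =>
          |hat (fun l => V l i j) l - hat (fun l => W l i j) l| + β i j) i j := by
    intro V W l i j sV sW hij h1 h2 hpos hlt
    have hle : W l i j ≤ V l i j := by
      rw [← sV.max_hat l, ← sW.max_hat l]
      exact max_le_max_right _ hlt.le
    have hFm := hF l i j hij (sW.nonneg l) (sV.nonneg l) hle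
    have hb := hβ i j hij
    obtain ⟨k1, k2, k3, k4⟩ := hI i j hij
    have := neighbourAverage_le (N := N)
      (V := fun i j => hat (fun l => V l i j) l - hat (fun l => W l i j) l + β i j)
      (W := fun i j => |hat (fun l => V l i j) l - hat (fun l => W l i j) l| + β i j)
      (fun i j _ _ _ _ => add_le_add_left (le_abs_self _) _) k1 k2 k3 k4
    rw [neighbourAverage_add, neighbourAverage_sub] at this
    linarith
  have main : D l i j ≤ B + d := by
    refine le_of_lt_neighbourAverage (W := D) ?_ ?_ l i j hi hi' hj hj'
    · intro l i j h1 h2 h3 h4 hb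
      have : ¬ I i j := by
        intro h
        have := hI i j h
        omega
      exact add_le_add (hnear l i j h1 h2 h3 h4 this) (hβ0 i j h1 h2 h3 h4).2
    · intro l i j h1 h2 h3 h4 hlt
      have sV := hV i j (by omega) (by omega) (by omega) (by omega)
      have sW := hW i j (by omega) (by omega) (by omega) (by omega)
      have hb0 := hβ0 i j (by omega) (by omega) (by omega) (by omega)
      have hij : I i j := by
        by_contra hij
        have := hnear l i j (by omega) (by omega) (by omega) (by omega) hij
        simp only [hD] at hlt
        linarith
      have sym : ∀ l, neighbourAverage (fun i j =>
          |hat (fun l => W l i j) l - hat (fun l => V l i j) l| + β i j) i j =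
          neighbourAverage (D l) i j := by
        intro l
        simp only [hD, abs_sub_comm]
      have hDpos : 0 < |hat (fun l => V l i j) l - hat (fun l => W l i j) l| := by
        simp only [hD] at hlt
        linarith
      have caseV : ∀ p, 0 < V p i j → hat (fun l => W l i j) p < hat (fun l => V l i j) p →
          hat (fun l => V l i j) p - hat (fun l => W l i j) p + β i j
            < neighbourAverage (D p) i j := fun p hp hpl =>
        key V W p i j sV sW hij (hVge p i j hij hp) (hWle p i j hij) hp hpl
      have caseW : ∀ p, 0 < W p i j → hat (fun l => V l i j) p < hat (fun l => W l i j) p →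
          hat (fun l => W l i j) p - hat (fun l => V l i j) p + β i j
            < neighbourAverage (D p) i j := fun p hp hpl => by
        rw [← sym]
        exact key W V p i j sW sV hij (hWge p i j hij hp) (hVle p i j hij) hp hpl
      rcases lt_or_gt_of_ne (sub_ne_zero.1 (abs_pos.1 hDpos)) with hc | hc
      · have hDe : D l i j = hat (fun l => W l i j) l - hat (fun l => V l i j) l + β i j := by
          simp only [hD]
          rw [abs_of_neg (by linarith)]
          ring
        rw [hDe]
        rcases sW.exists_pos_of_hat_lt sV hc with hp | ⟨p, hp, hle⟩
        · exact ⟨l, caseW l hp hc⟩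
        · exact ⟨p, lt_of_le_of_lt (by linarith) (caseV p hp (by linarith))⟩
      · have hDe : D l i j = hat (fun l => V l i j) l - hat (fun l => W l i j) l + β i j := by
          simp only [hD]
          rw [abs_of_pos (by linarith)]
        rw [hDe]
        rcases sV.exists_pos_of_hat_lt sW hc with hp | ⟨p, hp, hle⟩
        · exact ⟨l, caseV l hp hc⟩
        · exact ⟨p, lt_of_le_of_lt (by linarith) (caseW p hp (by linarith))⟩
  have := (hβ0 i j hi hi' hj hj').1
  simp only [hD] at main
  linarith

/-! ### Mesh points -/

section Mesh

variable {a : ℝ} {N : ℕ}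

lemma natCast_mul_div (hN : 0 < N) : (N : ℝ) * (a / N) = a := by
  have : (N : ℝ) ≠ 0 := by positivity
  field_simp

lemma mul_div_mem_Icc (ha : 0 < a) (hN : 0 < N) {i : ℤ} (h0 : 0 ≤ i) (h1 : i ≤ N) :
    (i : ℝ) * (a / N) ∈ Set.Icc 0 a := by
  have hN' : (0 : ℝ) < N := by positivity
  have h0' : (0 : ℝ) ≤ i := by exact_mod_cast h0
  have h1' : (i : ℝ) ≤ N := by exact_mod_cast h1
  have hh : 0 < a / N := by positivity
  refine ⟨by positivity, ?_⟩
  calc (i : ℝ) * (a / N) ≤ N * (a / N) := by gcongr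
    _ = a := natCast_mul_div hN

lemma mul_div_mem_Ioo (ha : 0 < a) (hN : 0 < N) {i : ℤ} (h0 : 1 ≤ i) (h1 : i ≤ N - 1) :
    (i : ℝ) * (a / N) ∈ Set.Ioo 0 a := by
  have hN' : (0 : ℝ) < N := by positivity
  have h0' : (0 : ℝ) < i := by exact_mod_cast h0
  have h1' : (i : ℝ) < N := by exact_mod_cast (show i < N by omega)
  have hh : 0 < a / N := by positivity
  refine ⟨by positivity, ?_⟩
  calc (i : ℝ) * (a / N) < N * (a / N) := by gcongr
    _ = a := natCast_mul_div hN

lemma gridPoint_mem_closedSquare (ha : 0 < a) (hN : 0 < N) {i j : ℤ} (hi : 0 ≤ i) (hi' : i ≤ N)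
    (hj : 0 ≤ j) (hj' : j ≤ N) : gridPoint a N i j ∈ closedSquare a :=
  ⟨mul_div_mem_Icc ha hN hi hi', mul_div_mem_Icc ha hN hj hj'⟩

lemma gridPoint_mem_openSquare (ha : 0 < a) (hN : 0 < N) {i j : ℤ} (hi : 1 ≤ i) (hi' : i ≤ N - 1)
    (hj : 1 ≤ j) (hj' : j ≤ N - 1) : gridPoint a N i j ∈ openSquare a :=
  ⟨mul_div_mem_Ioo ha hN hi hi', mul_div_mem_Ioo ha hN hj hj'⟩

lemma gridPoint_mem_squareBoundary (ha : 0 < a) (hN : 0 < N) {i j : ℤ} (hi : 0 ≤ i) (hi' : i ≤ N)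
    (hj : 0 ≤ j) (hj' : j ≤ N) (hb : i = 0 ∨ i = N ∨ j = 0 ∨ j = N) :
    gridPoint a N i j ∈ squareBoundary a := by
  refine ⟨gridPoint_mem_closedSquare ha hN hi hi' hj hj', ?_⟩
  rintro ⟨⟨h1, h2⟩, h3, h4⟩
  simp only [gridPoint] at h1 h2 h3 h4
  rcases hb with rfl | rfl | rfl | rfl
  · simp at h1
  · rw [Int.cast_natCast, natCast_mul_div hN] at h2
    exact h2.false
  · simp at h3
  · rw [Int.cast_natCast, natCast_mul_div hN] at h4
    exact h4.false

/-- The mesh function `|z - (x₀, y₀)|²`. -/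
noncomputable def meshSqDist (a : ℝ) (N : ℕ) (z₀ : ℝ × ℝ) (i j : ℤ) : ℝ :=
  (i * (a / N) - z₀.1) ^ 2 + (j * (a / N) - z₀.2) ^ 2

lemma meshSqDist_nonneg (z₀ : ℝ × ℝ) (i j : ℤ) : 0 ≤ meshSqDist a N z₀ i j := by
  unfold meshSqDist; positivity

lemma neighbourAverage_meshSqDist (z₀ : ℝ × ℝ) (i j : ℤ) :
    neighbourAverage (meshSqDist a N z₀) i j = meshSqDist a N z₀ i j + (a / N) ^ 2 := by
  unfold neighbourAverage meshSqDist
  push_cast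
  ring

end Mesh

/-! ### Solutions of the scheme -/

lemma IsInternalDynamics.nonneg {a : ℝ} {f : ℝ × ℝ → ℝ → ℝ} (hf : IsInternalDynamics a f)
    {z : ℝ × ℝ} (hz : z ∈ openSquare a) {s : ℝ} (hs : 0 ≤ s) : 0 ≤ f z s :=
  (hf.nonneg_zero z hz).trans (hf.monotone z hz 0 s le_rfl hs)

section Scheme

variable {m : ℕ} {a : ℝ} {N : ℕ} {f : Fin m → ℝ × ℝ → ℝ → ℝ}
  {φ : Fin m → ℝ × ℝ → ℝ} {U : Fin m → ℤ → ℤ → ℝ}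

/-- The mesh function `Û_l`. -/
noncomputable def meshHat (U : Fin m → ℤ → ℤ → ℝ) (l : Fin m) (i j : ℤ) : ℝ :=
  hat (fun l => U l i j) l

lemma neighbourAverage_meshHat (U : Fin m → ℤ → ℤ → ℝ) (l : Fin m) (i j : ℤ) :
    neighbourAverage (meshHat U l) i j
      = neighbourAverage (U l) i j - ∑ p ∈ Finset.univ.erase l, neighbourAverage (U p) i j :=
  neighbourAverage_hat U l i j

lemma IsSchemeSolution.eq_max (hU : IsSchemeSolution a N f φ U) (l : Fin m) {i j : ℤ}
    (hi : 1 ≤ i) (hi' : i ≤ N - 1) (hj : 1 ≤ j) (hj' : j ≤ N - 1) :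
    U l i j = max (neighbourAverage (meshHat U l) i j
      - (a / N) ^ 2 / 4 * f l (gridPoint a N i j) (U l i j)) 0 := by
  conv_lhs => rw [hU.interior l i j hi hi' hj hj']
  rw [neighbourAverage_meshHat]
  congr 1
  ring

lemma IsSchemeSolution.nonneg (ha : 0 < a) (hN : 0 < N)
    (hφ : ∀ l, ∀ z ∈ squareBoundary a, 0 ≤ φ l z)
    (hU : IsSchemeSolution a N f φ U) (l : Fin m) {i j : ℤ}
    (hi : 0 ≤ i) (hi' : i ≤ N) (hj : 0 ≤ j) (hj' : j ≤ N) : 0 ≤ U l i j := by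
  by_cases hb : i = 0 ∨ i = N ∨ j = 0 ∨ j = N
  · rw [hU.boundary l i j hi hi' hj hj' hb]
    exact hφ l _ (gridPoint_mem_squareBoundary ha hN hi hi' hj hj' hb)
  · rw [hU.eq_max l (by omega) (by omega) (by omega) (by omega)]
    exact le_max_right _ _

lemma IsSchemeSolution.neighbourAverage_meshHat_of_pos
    (hU : IsSchemeSolution a N f φ U) (l : Fin m) {i j : ℤ}
    (hi : 1 ≤ i) (hi' : i ≤ N - 1) (hj : 1 ≤ j) (hj' : j ≤ N - 1) (hpos : 0 < U l i j) :
    neighbourAverage (meshHat U l) i j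
      = U l i j + (a / N) ^ 2 / 4 * f l (gridPoint a N i j) (U l i j) := by
  have h := hU.eq_max l hi hi' hj hj'
  rcases max_choice (neighbourAverage (meshHat U l) i j
      - (a / N) ^ 2 / 4 * f l (gridPoint a N i j) (U l i j)) 0 with h' | h'
  · linarith
  · linarith

lemma neighbourAverage_meshHat_le_neg (ha : 0 < a) (hN : 0 < N)
    (hφ : ∀ l, ∀ z ∈ squareBoundary a, 0 ≤ φ l z) (hU : IsSchemeSolution a N f φ U) {l p : Fin m} (hlp : l ≠ p) {i j : ℤ}
    (hi : 1 ≤ i) (hi' : i ≤ N - 1) (hj : 1 ≤ j) (hj' : j ≤ N - 1) :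
    neighbourAverage (meshHat U l) i j ≤ -neighbourAverage (meshHat U p) i j := by
  rw [← neighbourAverage_neg]
  exact neighbourAverage_le (N := N) (fun i j h1 h2 h3 h4 => hat_le_neg_hat
    (fun l => hU.nonneg ha hN hφ l h1 h2 h3 h4) hlp) hi hi' hj hj'

/-! ### Segregation, differential inequalities and barriers for scheme solutions -/

variable (ha : 0 < a) (hN : 0 < N) (hf : ∀ l, IsInternalDynamics a (f l))
  (hφ : ∀ l, ∀ z ∈ squareBoundary a, 0 ≤ φ l z)
  (hφs : ∀ l p, l ≠ p → ∀ z ∈ squareBoundary a, φ l z * φ p z = 0)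
  (hU : IsSchemeSolution a N f φ U)

include ha hN hf hφ hφs hU

/-- If two components were positive at an interior point, then, f being nonnegative, both hats would
have positive neighbour averages; but these averages have nonpositive sum. -/
lemma IsSchemeSolution.isSegregated {i j : ℤ}
    (hi : 0 ≤ i) (hi' : i ≤ N) (hj : 0 ≤ j) (hj' : j ≤ N) : IsSegregated fun l => U l i j := by
  refine ⟨fun l => hU.nonneg ha hN hφ l hi hi' hj hj', fun l p hlp => ?_⟩
  by_cases hb : i = 0 ∨ i = N ∨ j = 0 ∨ j = N
  · rw [hU.boundary l i j hi hi' hj hj' hb, hU.boundary p i j hi hi' hj hj' hb]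
    exact hφs l p hlp _ (gridPoint_mem_squareBoundary ha hN hi hi' hj hj' hb)
  · have k1 : 1 ≤ i := by omega
    have k2 : i ≤ N - 1 := by omega
    have k3 : 1 ≤ j := by omega
    have k4 : j ≤ N - 1 := by omega
    have hz := gridPoint_mem_openSquare ha hN k1 k2 k3 k4
    by_contra hne
    have h0l := hU.nonneg ha hN hφ l hi hi' hj hj'
    have h0p := hU.nonneg ha hN hφ p hi hi' hj hj'
    have hl : 0 < U l i j := lt_of_le_of_ne h0l (fun h => hne (by simp [← h]))
    have hp : 0 < U p i j := lt_of_le_of_ne h0p (fun h => hne (by simp [← h]))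
    have e1 := hU.neighbourAverage_meshHat_of_pos l k1 k2 k3 k4 hl
    have e2 := hU.neighbourAverage_meshHat_of_pos p k1 k2 k3 k4 hp
    have e3 := neighbourAverage_meshHat_le_neg ha hN hφ hU hlp k1 k2 k3 k4
    have f1 := mul_nonneg (by positivity : 0 ≤ (a / N) ^ 2 / 4) ((hf l).nonneg hz h0l)
    have f2 := mul_nonneg (by positivity : 0 ≤ (a / N) ^ 2 / 4) ((hf p).nonneg hz h0p)
    linarith

/-- Where `U l` is positive this is an equality. Where another `U p` is positive, the hat equals `-U
p`, and its average is at most minus that of the `p`-th hat, hence at most `-U p`. Where all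
components vanish, the maximum in the scheme is 0, which bounds its first argument. -/
lemma IsSchemeSolution.neighbourAverage_meshHat_le (l : Fin m) {i j : ℤ}
    (hi : 1 ≤ i) (hi' : i ≤ N - 1) (hj : 1 ≤ j) (hj' : j ≤ N - 1) :
    neighbourAverage (meshHat U l) i j - meshHat U l i j
      ≤ (a / N) ^ 2 / 4 * f l (gridPoint a N i j) (U l i j) := by
  have hs := hU.isSegregated ha hN hf hφ hφs (i := i) (j := j)
    (by omega) (by omega) (by omega) (by omega)
  have hz := gridPoint_mem_openSquare ha hN hi hi' hj hj'
  have hF : ∀ l, 0 ≤ (a / N) ^ 2 / 4 * f l (gridPoint a N i j) (U l i j) := fun l =>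
    mul_nonneg (by positivity) ((hf l).nonneg hz (hs.nonneg l))
  by_cases hex : ∃ p, 0 < U p i j
  · obtain ⟨p, hp⟩ := hex
    have e1 := hU.neighbourAverage_meshHat_of_pos p hi hi' hj hj' hp
    by_cases hpl : l = p
    · subst hpl
      rw [e1, meshHat, hs.hat_of_pos hp]
      linarith
    · have e2 := neighbourAverage_meshHat_le_neg ha hN hφ hU hpl hi hi' hj hj'
      have e3 : meshHat U l i j = -U p i j := by
        unfold meshHat hat
        rw [show (fun l => U l i j) l = 0 from hs.eq_zero_of_pos hp hpl, Finset.sum_eq_single_of_mem p (by simp [Ne.symm hpl])]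
        · ring
        · intro q _ hq
          exact hs.eq_zero_of_pos hp hq
      linarith [hF l, hF p]
  · push Not at hex
    have e3 : meshHat U l i j = 0 := by
      unfold meshHat hat
      rw [Finset.sum_eq_zero fun p _ => le_antisymm (hex p) (hs.nonneg p),
        sub_zero]
      exact le_antisymm (hex l) (hs.nonneg l)
    have := le_max_left (neighbourAverage (meshHat U l) i j
      - (a / N) ^ 2 / 4 * f l (gridPoint a N i j) (U l i j)) 0
    rw [← hU.eq_max l hi hi' hj hj'] at this
    linarith [hex l]

/-- The scheme only subtracts nonnegative terms from the average, so each component is discretely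
subharmonic. -/
lemma IsSchemeSolution.le_neighbourAverage (l : Fin m) {i j : ℤ}
    (hi : 1 ≤ i) (hi' : i ≤ N - 1) (hj : 1 ≤ j) (hj' : j ≤ N - 1) :
    U l i j ≤ neighbourAverage (U l) i j := by
  have hs := hU.isSegregated ha hN hf hφ hφs (i := i) (j := j)
    (by omega) (by omega) (by omega) (by omega)
  have hz := gridPoint_mem_openSquare ha hN hi hi' hj hj'
  rw [hU.eq_max l hi hi' hj hj']
  have hle : neighbourAverage (meshHat U l) i j ≤ neighbourAverage (U l) i j :=
    neighbourAverage_le (N := N) (fun i j h1 h2 h3 h4 => hat_le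
      (fun l => hU.nonneg ha hN hφ l h1 h2 h3 h4) l) hi hi' hj hj'
  have h0 : neighbourAverage (fun _ _ => 0) i j ≤ neighbourAverage (U l) i j :=
    neighbourAverage_le (N := N) (fun i j h1 h2 h3 h4 =>
      hU.nonneg ha hN hφ l h1 h2 h3 h4) hi hi' hj hj'
  have h1 : neighbourAverage (fun _ _ => 0) i j = 0 := by unfold neighbourAverage; ring
  have hF : 0 ≤ (a / N) ^ 2 / 4 * f l (gridPoint a N i j) (U l i j) :=
    mul_nonneg (by positivity) ((hf l).nonneg hz (hs.nonneg l))
  exact max_le (by linarith) (by linarith)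

/-- A bound independent of the mesh, which keeps the arguments of f in a fixed interval. The term `2
* a ^ 2` bounds the |z|² added to make the maximum principle strict. -/
lemma IsSchemeSolution.le_of_boundary_le {M : ℝ} (l : Fin m)
    (hM : ∀ z ∈ squareBoundary a, φ l z ≤ M) {i j : ℤ}
    (hi : 0 ≤ i) (hi' : i ≤ N) (hj : 0 ≤ j) (hj' : j ≤ N) : U l i j ≤ M + 2 * a ^ 2 := by
  have hd : ∀ i j : ℤ, 0 ≤ i → i ≤ N → 0 ≤ j → j ≤ N →
      meshSqDist a N (0, 0) i j ≤ 2 * a ^ 2 := by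
    intro i j h1 h2 h3 h4
    obtain ⟨x0, x1⟩ := mul_div_mem_Icc ha hN h1 h2
    obtain ⟨y0, y1⟩ := mul_div_mem_Icc ha hN h3 h4
    unfold meshSqDist
    simp only [sub_zero]
    nlinarith
  have := le_of_lt_neighbourAverage (ι := Unit) (N := N) (B := M + 2 * a ^ 2)
    (W := fun _ i j => U l i j + meshSqDist a N (0, 0) i j) ?_ ?_ () i j hi hi' hj hj'
  · linarith [meshSqDist_nonneg (a := a) (N := N) (0, 0) i j]
  · intro _ i j h1 h2 h3 h4 hb
    have := hM _ (gridPoint_mem_squareBoundary ha hN h1 h2 h3 h4 hb)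
    have := hd i j h1 h2 h3 h4
    simp only [hU.boundary l i j h1 h2 h3 h4 hb]
    linarith
  · intro _ i j h1 h2 h3 h4 _
    refine ⟨(), ?_⟩
    rw [neighbourAverage_add, neighbourAverage_meshSqDist]
    have := hU.le_neighbourAverage ha hN hf hφ hφs l h1 h2 h3 h4
    have h' : 0 < (a / N) ^ 2 := by positivity
    linarith

/-- Barrier estimate near a boundary point `z₀`. -/
lemma IsSchemeSolution.abs_sub_le_barrier {w : Fin m → ℝ × ℝ → ℝ}
    (hw : ∀ l, ∀ z ∈ squareBoundary a, w l z = φ l z) (l : Fin m) {ε C K : ℝ}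
    {z₀ : ℝ × ℝ} (hz₀ : z₀ ∈ squareBoundary a)
    (hC : ∀ z ∈ squareBoundary a,
      |w l z - w l z₀| ≤ ε + C * ((z.1 - z₀.1) ^ 2 + (z.2 - z₀.2) ^ 2))
    (hC' : ∀ z ∈ squareBoundary a, |hat (fun l => w l z) l - hat (fun l => w l z₀) l|
      ≤ ε + C * ((z.1 - z₀.1) ^ 2 + (z.2 - z₀.2) ^ 2))
    (hK : ∀ i j : ℤ, 1 ≤ i → i ≤ N - 1 → 1 ≤ j → j ≤ N - 1 →
      f l (gridPoint a N i j) (U l i j) ≤ K)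
    (hC0 : 0 ≤ C) (hK0 : 0 ≤ K) {q : ℤ → ℤ → ℝ}
    (hq0 : ∀ i j : ℤ, 0 ≤ i → i ≤ N → 0 ≤ j → j ≤ N → 0 ≤ q i j)
    (hq : ∀ i j : ℤ, neighbourAverage q i j = q i j - (a / N) ^ 2 / 2) {i j : ℤ}
    (hi : 0 ≤ i) (hi' : i ≤ N) (hj : 0 ≤ j) (hj' : j ≤ N) :
    |U l i j - w l z₀| ≤ ε + C * meshSqDist a N z₀ i j + (2 * C + K + 1) * q i j := by
  have hh : 0 < (a / N) ^ 2 := by positivity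
  -- The average raises `C * meshSqDist` by C h² and lowers `q` by h²/2, so subtracting the barrier
  -- with this coefficient gains (K+1)h²/2. This outweighs the error K h²/4 in the lower bound.
  have hA : 0 ≤ 2 * C + K + 1 := by positivity
  have up : U l i j - (C * meshSqDist a N z₀ i j + (2 * C + K + 1) * q i j) ≤ w l z₀ + ε := by
    refine le_of_lt_neighbourAverage (ι := Unit) (N := N) (B := w l z₀ + ε)
      (W := fun _ i j => U l i j - (C * meshSqDist a N z₀ i j + (2 * C + K + 1) * q i j))
      ?_ ?_ () i j hi hi' hj hj'
    · intro _ i j h1 h2 h3 h4 hb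
      have hz := gridPoint_mem_squareBoundary ha hN h1 h2 h3 h4 hb
      have := (abs_le.1 (hC _ hz)).2
      have := mul_nonneg hA (hq0 i j h1 h2 h3 h4)
      simp only [hU.boundary l i j h1 h2 h3 h4 hb, ← hw l _ hz]
      simp only [meshSqDist, gridPoint] at *
      linarith
    · intro _ i j h1 h2 h3 h4 _
      refine ⟨(), ?_⟩
      rw [neighbourAverage_sub, neighbourAverage_add, neighbourAverage_const_mul,
        neighbourAverage_const_mul, neighbourAverage_meshSqDist, hq]
      have := hU.le_neighbourAverage ha hN hf hφ hφs l h1 h2 h3 h4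
      nlinarith [mul_nonneg hK0 hh.le]
  -- The lower bound is proved for the hat, whose discrete Laplacian is bounded above; that of `U l`
  -- is not so controlled where `U l` vanishes. The positive part then brings the bound back to `U
  -- l`.
  have lo : -(meshHat U l i j) - (C * meshSqDist a N z₀ i j + (2 * C + K + 1) * q i j)
      ≤ -hat (fun l => w l z₀) l + ε := by
    refine le_of_lt_neighbourAverage (ι := Unit) (N := N) (B := -hat (fun l => w l z₀) l + ε)
      (W := fun _ i j => -meshHat U l i j
        - (C * meshSqDist a N z₀ i j + (2 * C + K + 1) * q i j))
      ?_ ?_ () i j hi hi' hj hj'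
    · intro _ i j h1 h2 h3 h4 hb
      have hz := gridPoint_mem_squareBoundary ha hN h1 h2 h3 h4 hb
      have := (abs_le.1 (hC' _ hz)).1
      have := mul_nonneg hA (hq0 i j h1 h2 h3 h4)
      have e : meshHat U l i j = hat (fun l => w l (gridPoint a N i j)) l := by
        unfold meshHat
        congr 1
        funext p
        rw [hU.boundary p i j h1 h2 h3 h4 hb, hw p _ hz]
      simp only [e]
      simp only [meshSqDist, gridPoint] at *
      linarith
    · intro _ i j h1 h2 h3 h4 _
      refine ⟨(), ?_⟩
      rw [neighbourAverage_sub, neighbourAverage_add, neighbourAverage_const_mul,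
        neighbourAverage_const_mul, neighbourAverage_meshSqDist, hq, neighbourAverage_neg]
      have := hU.neighbourAverage_meshHat_le ha hN hf hφ hφs l h1 h2 h3 h4
      have := mul_le_mul_of_nonneg_left (hK i j h1 h2 h3 h4)
        (by positivity : 0 ≤ (a / N) ^ 2 / 4)
      nlinarith [mul_nonneg hK0 hh.le]
  have hs := hU.isSegregated ha hN hf hφ hφs hi hi' hj hj'
  have hw0 : IsSegregated fun l => w l z₀ :=
    ⟨fun l => by simpa only [hw l _ hz₀] using hφ l _ hz₀,
      fun l p hlp => by simpa only [hw _ _ hz₀] using hφs l p hlp _ hz₀⟩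
  have hε : 0 ≤ ε := by simpa using hC z₀ hz₀
  rw [abs_le]
  refine ⟨?_, by linarith⟩
  have e0 : w l z₀ = max (hat (fun l => w l z₀) l) 0 := (hw0.max_hat l).symm
  have h1 : meshHat U l i j ≤ U l i j := hat_le hs.nonneg l
  have h2 : 0 ≤ U l i j := hs.nonneg l
  have h3 := mul_nonneg hC0 (meshSqDist_nonneg (a := a) (N := N) z₀ i j)
  have h4 := mul_nonneg hA (hq0 i j hi hi' hj hj')
  have : w l z₀ ≤ U l i j + (ε + C * meshSqDist a N z₀ i j + (2 * C + K + 1) * q i j) := by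
    rw [e0]
    exact max_le (by linarith) (by linarith)
  linarith

end Scheme

/-! ### Consistency of the five-point Laplacian -/

/-- Subtracting c/2 (t - s)² leaves a concave function, and midpoint concavity at s is the claim; no
derivative beyond the second enters. -/
lemma second_difference_le {g g' g'' : ℝ → ℝ} {s h c : ℝ} (hh : 0 ≤ h)
    (hg : ∀ t ∈ Set.Icc (s - h) (s + h), HasDerivAt g (g' t) t)
    (hg' : ∀ t ∈ Set.Icc (s - h) (s + h), HasDerivAt g' (g'' t) t)
    (hc : ∀ t ∈ Set.Icc (s - h) (s + h), g'' t ≤ c) :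
    g (s - h) + g (s + h) - 2 * g s ≤ c * h ^ 2 := by
  have hconc : ConcaveOn ℝ (Set.Icc (s - h) (s + h)) (fun t => g t - c / 2 * (t - s) ^ 2) := by
    refine concaveOn_of_hasDerivWithinAt2_nonpos (convex_Icc _ _)
      (f' := fun t => g' t - c * (t - s)) (f'' := fun t => g'' t - c) ?_ ?_ ?_ ?_
    · exact ContinuousOn.sub (fun t ht => (hg t ht).continuousAt.continuousWithinAt)
        (by fun_prop)
    · intro t ht
      have h1 := hg t (interior_subset ht)
      have h2 : HasDerivAt (fun t => c / 2 * (t - s) ^ 2) (c * (t - s)) t := by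
        have := (((hasDerivAt_id t).sub_const s).pow 2).const_mul (c / 2)
        convert! this using 1
        simp
        ring
      exact (h1.sub h2).hasDerivWithinAt
    · intro t ht
      have h1 := hg' t (interior_subset ht)
      have h2 : HasDerivAt (fun t => c * (t - s)) c t := by
        simpa using ((hasDerivAt_id t).sub_const s).const_mul c
      exact (h1.sub h2).hasDerivWithinAt
    · intro t ht
      linarith [hc t (interior_subset ht)]
  obtain ⟨-, hcc⟩ := hconc
  have := hcc (x := s - h) ⟨le_rfl, by linarith⟩ (y := s + h) ⟨by linarith, le_rfl⟩
    (a := 1 / 2) (b := 1 / 2) (by norm_num) (by norm_num) (by norm_num)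
  simp only [smul_eq_mul] at this
  have e : 1 / 2 * (s - h) + 1 / 2 * (s + h) = s := by ring
  rw [e] at this
  nlinarith

lemma abs_second_difference_sub_le {g g' g'' : ℝ → ℝ} {s h c η : ℝ} (hh : 0 ≤ h)
    (hg : ∀ t ∈ Set.Icc (s - h) (s + h), HasDerivAt g (g' t) t)
    (hg' : ∀ t ∈ Set.Icc (s - h) (s + h), HasDerivAt g' (g'' t) t)
    (hc : ∀ t ∈ Set.Icc (s - h) (s + h), |g'' t - c| ≤ η) :
    |g (s - h) + g (s + h) - 2 * g s - c * h ^ 2| ≤ η * h ^ 2 := by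
  have h1 := second_difference_le (c := c + η) hh hg hg'
    (fun t ht => by linarith [(abs_le.1 (hc t ht)).2])
  have h2 := second_difference_le (g := fun t => -g t) (g' := fun t => -g' t)
    (g'' := fun t => -g'' t) (c := -c + η) hh (fun t ht => (hg t ht).neg)
    (fun t ht => (hg' t ht).neg) (fun t ht => by linarith [(abs_le.1 (hc t ht)).1])
  rw [abs_le]
  constructor <;> linarith

/-- The classical Laplacian. -/
noncomputable def lap (w : ℝ × ℝ → ℝ) (z : ℝ × ℝ) : ℝ :=
  partialX (partialX w) z + partialY (partialY w) z

lemma isOpen_openSquare (a : ℝ) : IsOpen (openSquare a) := isOpen_Ioo.prod isOpen_Ioo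

section C2

variable {a : ℝ} {w : ℝ × ℝ → ℝ}

lemma contDiffOn_partialX {n : ℕ} (hw : ContDiffOn ℝ (n + 1 : ℕ) w (openSquare a)) :
    ContDiffOn ℝ n (partialX w) (openSquare a) :=
  (hw.fderiv_of_isOpen (isOpen_openSquare a) (m := n) (by norm_cast)).clm_apply contDiffOn_const

lemma contDiffOn_partialY {n : ℕ} (hw : ContDiffOn ℝ (n + 1 : ℕ) w (openSquare a)) :
    ContDiffOn ℝ n (partialY w) (openSquare a) :=
  (hw.fderiv_of_isOpen (isOpen_openSquare a) (m := n) (by norm_cast)).clm_apply contDiffOn_const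

lemma hasDerivAt_partialX {z : ℝ × ℝ} (hw : DifferentiableAt ℝ w z) :
    HasDerivAt (fun t => w (t, z.2)) (partialX w z) z.1 := by
  have h := hw.hasFDerivAt.comp_hasDerivAt (f := fun t : ℝ => (t, z.2)) z.1
    ((hasDerivAt_id z.1).prodMk (hasDerivAt_const z.1 z.2))
  exact h

lemma hasDerivAt_partialY {z : ℝ × ℝ} (hw : DifferentiableAt ℝ w z) :
    HasDerivAt (fun t => w (z.1, t)) (partialY w z) z.2 := by
  have h := hw.hasFDerivAt.comp_hasDerivAt (f := fun t : ℝ => (z.1, t)) z.2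
    ((hasDerivAt_const z.2 z.1).prodMk (hasDerivAt_id z.2))
  exact h

variable (hw : ContDiffOn ℝ 2 w (openSquare a))

include hw

lemma differentiableAt_of_contDiffOn {z : ℝ × ℝ} (hz : z ∈ openSquare a) :
    DifferentiableAt ℝ w z ∧ DifferentiableAt ℝ (partialX w) z ∧
      DifferentiableAt ℝ (partialY w) z := by
  have hn := (isOpen_openSquare a).mem_nhds hz
  exact ⟨(hw.differentiableOn (by norm_num)).differentiableAt hn,
    ((contDiffOn_partialX (n := 1) hw).differentiableOn (by norm_num)).differentiableAt hn,
    ((contDiffOn_partialY (n := 1) hw).differentiableOn (by norm_num)).differentiableAt hn⟩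

lemma continuousOn_partialX_partialX : ContinuousOn (partialX (partialX w)) (openSquare a) :=
  (contDiffOn_partialX (n := 0) (contDiffOn_partialX (n := 1) hw)).continuousOn

lemma continuousOn_partialY_partialY : ContinuousOn (partialY (partialY w)) (openSquare a) :=
  (contDiffOn_partialY (n := 0) (contDiffOn_partialY (n := 1) hw)).continuousOn

lemma continuousOn_lap : ContinuousOn (lap w) (openSquare a) :=
  (continuousOn_partialX_partialX hw).add (continuousOn_partialY_partialY hw)

/-- The scaled five-point Laplacian is consistent, uniformly on compact subsets. -/
lemma exists_abs_fivePoint_sub_le {ρ η : ℝ} (hρ : 0 < ρ) (hη : 0 < η) :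
    ∃ h₀ > 0, ∀ h, 0 ≤ h → h < h₀ → ∀ x ∈ Set.Icc ρ (a - ρ), ∀ y ∈ Set.Icc ρ (a - ρ),
      |1 / 4 * (w (x - h, y) + w (x + h, y) + w (x, y - h) + w (x, y + h)) - w (x, y)
        - h ^ 2 / 4 * lap w (x, y)| ≤ η * h ^ 2 := by
  -- The margin ρ/2 keeps every stencil of step h < ρ/2 in one compact subset of Ω, where the second
  -- derivatives are uniformly continuous.
  set K : Set (ℝ × ℝ) := Set.Icc (ρ / 2) (a - ρ / 2) ×ˢ Set.Icc (ρ / 2) (a - ρ / 2) with hKdef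
  have hK : IsCompact K := isCompact_Icc.prod isCompact_Icc
  have hKsub : K ⊆ openSquare a := by
    rintro ⟨x, y⟩ ⟨⟨h1, h2⟩, h3, h4⟩
    simp only at h1 h2 h3 h4
    exact ⟨⟨by simp only; linarith, by simp only; linarith⟩,
      by simp only; linarith, by simp only; linarith⟩
  have ux := hK.uniformContinuousOn_of_continuous ((continuousOn_partialX_partialX hw).mono hKsub)
  have uy := hK.uniformContinuousOn_of_continuous ((continuousOn_partialY_partialY hw).mono hKsub)
  obtain ⟨δ₁, hδ₁, H₁⟩ := Metric.uniformContinuousOn_iff.1 ux η hη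
  obtain ⟨δ₂, hδ₂, H₂⟩ := Metric.uniformContinuousOn_iff.1 uy η hη
  refine ⟨min (ρ / 2) (min δ₁ δ₂), by positivity, ?_⟩
  intro h hh hh0 x hx y hy
  obtain ⟨k1, k2, k3⟩ : h < ρ / 2 ∧ h < δ₁ ∧ h < δ₂ := by simpa [lt_min_iff] using hh0
  obtain ⟨hx1, hx2⟩ := hx
  obtain ⟨hy1, hy2⟩ := hy
  have mem0 : (x, y) ∈ K := ⟨⟨by simp only; linarith, by simp only; linarith⟩,
      by simp only; linarith, by simp only; linarith⟩
  have memX : ∀ t ∈ Set.Icc (x - h) (x + h), (t, y) ∈ K := fun t ht =>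
    ⟨⟨by simp only; linarith [ht.1], by simp only; linarith [ht.2]⟩,
      by simp only; linarith, by simp only; linarith⟩
  have memY : ∀ t ∈ Set.Icc (y - h) (y + h), (x, t) ∈ K := fun t ht =>
    ⟨⟨by simp only; linarith, by simp only; linarith⟩,
      by simp only; linarith [ht.1], by simp only; linarith [ht.2]⟩
  have eX := abs_second_difference_sub_le (g := fun t => w (t, y))
    (g' := fun t => partialX w (t, y)) (g'' := fun t => partialX (partialX w) (t, y))
    (c := partialX (partialX w) (x, y)) (η := η) hh
    (fun t ht => hasDerivAt_partialX (differentiableAt_of_contDiffOn hw (hKsub (memX t ht))).1)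
    (fun t ht => hasDerivAt_partialX (differentiableAt_of_contDiffOn hw (hKsub (memX t ht))).2.1)
    (fun t ht => by
      have := H₁ (t, y) (memX t ht) (x, y) mem0 (by
        rw [Prod.dist_eq]
        refine max_lt ?_ (by simpa using hδ₁)
        rw [Real.dist_eq]
        exact (abs_le.2 ⟨by linarith [ht.1], by linarith [ht.2]⟩ : |t - x| ≤ h).trans_lt k2)
      rw [Real.dist_eq] at this
      exact this.le)
  have eY := abs_second_difference_sub_le (g := fun t => w (x, t))
    (g' := fun t => partialY w (x, t)) (g'' := fun t => partialY (partialY w) (x, t))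
    (c := partialY (partialY w) (x, y)) (η := η) hh
    (fun t ht => hasDerivAt_partialY (differentiableAt_of_contDiffOn hw (hKsub (memY t ht))).1)
    (fun t ht => hasDerivAt_partialY (differentiableAt_of_contDiffOn hw (hKsub (memY t ht))).2.2)
    (fun t ht => by
      have := H₂ (x, t) (memY t ht) (x, y) mem0 (by
        rw [Prod.dist_eq]
        refine max_lt (by simpa using hδ₂) ?_
        rw [Real.dist_eq]
        exact (abs_le.2 ⟨by linarith [ht.1], by linarith [ht.2]⟩ : |t - y| ≤ h).trans_lt k3)
      rw [Real.dist_eq] at this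
      exact this.le)
  rw [abs_le] at eX eY ⊢
  have : 0 ≤ η * h ^ 2 := by positivity
  unfold lap
  constructor <;> nlinarith

end C2

/-! ### Moduli of continuity and bounds -/

lemma isCompact_closedSquare (a : ℝ) : IsCompact (closedSquare a) :=
  isCompact_Icc.prod isCompact_Icc

lemma openSquare_subset_closedSquare (a : ℝ) : openSquare a ⊆ closedSquare a :=
  Set.prod_mono Set.Ioo_subset_Icc_self Set.Ioo_subset_Icc_self

/-- A continuous function on a compact set has a quadratic modulus of continuity up to `ε`. -/
lemma exists_abs_sub_le_add_mul_sq {s : Set (ℝ × ℝ)} (hs : IsCompact s) {w : ℝ × ℝ → ℝ}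
    (hw : ContinuousOn w s) {ε : ℝ} (hε : 0 < ε) :
    ∃ C, 0 ≤ C ∧ ∀ z ∈ s, ∀ z₀ ∈ s,
      |w z - w z₀| ≤ ε + C * ((z.1 - z₀.1) ^ 2 + (z.2 - z₀.2) ^ 2) := by
  obtain ⟨M, hM⟩ := hs.exists_bound_of_continuousOn hw
  obtain ⟨δ, hδ, H⟩ := Metric.uniformContinuousOn_iff.1 (hs.uniformContinuousOn_of_continuous hw)
    ε hε
  -- Beyond the uniform continuity radius δ the quadratic term is at least 2|M|, which bounds any
  -- difference of values.
  refine ⟨2 * |M| / δ ^ 2, by positivity, fun z hz z₀ hz₀ => ?_⟩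
  by_cases hd : dist z z₀ < δ
  · have := H z hz z₀ hz₀ hd
    rw [Real.dist_eq] at this
    have : 0 ≤ 2 * |M| / δ ^ 2 * ((z.1 - z₀.1) ^ 2 + (z.2 - z₀.2) ^ 2) := by positivity
    linarith
  · push Not at hd
    have h1 : |w z - w z₀| ≤ 2 * |M| := by
      have h1 := (hM z hz).trans (le_abs_self M)
      have h2 := (hM z₀ hz₀).trans (le_abs_self M)
      have := abs_sub (w z) (w z₀)
      rw [Real.norm_eq_abs] at h1 h2
      linarith
    have h2 : δ ^ 2 ≤ (z.1 - z₀.1) ^ 2 + (z.2 - z₀.2) ^ 2 := by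
      rw [Prod.dist_eq, le_max_iff, Real.dist_eq, Real.dist_eq] at hd
      rcases hd with hd | hd
      · have := pow_le_pow_left₀ hδ.le hd 2
        rw [sq_abs] at this
        nlinarith
      · have := pow_le_pow_left₀ hδ.le hd 2
        rw [sq_abs] at this
        nlinarith
    have h3 : 2 * |M| = 2 * |M| / δ ^ 2 * δ ^ 2 := by field_simp
    have h4 := mul_le_mul_of_nonneg_left h2 (by positivity : 0 ≤ 2 * |M| / δ ^ 2)
    linarith

/-- A uniformly continuous function on a totally bounded set is bounded, and monotonicity in s
reduces all arguments to the largest one. -/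
lemma IsInternalDynamics.exists_bound {a : ℝ} {f : ℝ × ℝ → ℝ → ℝ}
    (hf : IsInternalDynamics a f) (R : ℝ) :
    ∃ K, 0 ≤ K ∧ ∀ z ∈ openSquare a, ∀ s, 0 ≤ s → s ≤ R → f z s ≤ K := by
  obtain ⟨δ, hδ, H⟩ := Metric.uniformContinuousOn_iff.1
    (hf.uniformContinuousOn (max R 0) (le_max_right _ _)) 1 one_pos
  have htb : TotallyBounded (openSquare a) :=
    (isCompact_closedSquare a).totallyBounded.subset (openSquare_subset_closedSquare a)
  obtain ⟨t, hts, htf, ht⟩ := htb.exists_subset (Metric.dist_mem_uniformity hδ)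
  obtain ⟨K, hK⟩ := (htf.image (fun z => f z (max R 0))).bddAbove
  refine ⟨max K 0 + 1, by positivity, fun z hz s hs hsR => ?_⟩
  obtain ⟨y, hy, hzy⟩ := Set.mem_iUnion₂.1 (ht hz)
  have h1 := H z hz y (hts hy) hzy
  rw [Real.dist_eq, abs_lt] at h1
  have h2 := hK (Set.mem_image_of_mem _ hy)
  have h3 := hf.monotone z hz s (max R 0) hs (hsR.trans (le_max_left _ _))
  have h4 := le_max_left K 0
  linarith

open MeasureTheory

/-! ### Test functions and integration by parts -/

/-- Smooth functions with compact support in `V`. -/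
structure IsTest (V : Set (ℝ × ℝ)) (η : ℝ × ℝ → ℝ) : Prop where
  contDiff : ContDiff ℝ ∞ η
  hasCompactSupport : HasCompactSupport η
  tsupport_subset : tsupport η ⊆ V

section Test

variable {V : Set (ℝ × ℝ)} {η : ℝ × ℝ → ℝ}

lemma IsTest.mono {V' : Set (ℝ × ℝ)} (hη : IsTest V η) (h : V ⊆ V') : IsTest V' η :=
  ⟨hη.1, hη.2, hη.3.trans h⟩

lemma IsTest.fderiv_apply (hη : IsTest V η) (v : ℝ × ℝ) : IsTest V fun z => fderiv ℝ η z v :=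
  ⟨(hη.contDiff.fderiv_right (m := ∞) (by norm_cast)).clm_apply contDiff_const,
    hη.hasCompactSupport.fderiv_apply (𝕜 := ℝ) v,
    (tsupport_fderiv_apply_subset ℝ v).trans hη.tsupport_subset⟩

lemma IsTest.partialX (hη : IsTest V η) : IsTest V (partialX η) := hη.fderiv_apply (1, 0)

lemma IsTest.partialY (hη : IsTest V η) : IsTest V (partialY η) := hη.fderiv_apply (0, 1)

lemma IsTest.continuous (hη : IsTest V η) : Continuous η := hη.contDiff.continuous

lemma IsTest.eq_zero (hη : IsTest V η) {z : ℝ × ℝ} (hz : z ∉ V) : η z = 0 :=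
  image_eq_zero_of_notMem_tsupport fun h => hz (hη.tsupport_subset h)

lemma IsTest.memLp (hη : IsTest V η) (a : ℝ) : MemLp η 2 (squareMeasure a) :=
  (hη.continuous.memLp_of_hasCompactSupport hη.hasCompactSupport).restrict _

lemma IsTest.integrable_mul {w : ℝ × ℝ → ℝ} (hV : IsOpen V) (hw : ContinuousOn w V)
    (hη : IsTest V η) : Integrable (fun z => w z * η z) := by
  refine Continuous.integrable_of_hasCompactSupport ?_ hη.hasCompactSupport.mul_left
  refine continuous_of_tsupport fun z hz => ?_
  have hz' : z ∈ V := hη.tsupport_subset (tsupport_mul_subset_right hz)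
  exact (hw.continuousAt (hV.mem_nhds hz')).mul hη.continuous.continuousAt

lemma IsTest.integral_mul_eq {a : ℝ} {w : ℝ × ℝ → ℝ} (hη : IsTest (openSquare a) η) :
    ∫ z, w z * η z ∂(squareMeasure a) = ∫ z, w z * η z :=
  setIntegral_eq_integral_of_forall_compl_eq_zero fun z hz => by rw [hη.eq_zero hz, mul_zero]

lemma IsTest.integral_mul_fderiv {a : ℝ} {w : ℝ × ℝ → ℝ} (hη : IsTest (openSquare a) η)
    (hw : ContDiffOn ℝ 1 w (openSquare a)) (v : ℝ × ℝ) :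
    ∫ z, w z * fderiv ℝ η z v ∂(squareMeasure a)
      = -∫ z, fderiv ℝ w z v * η z ∂(squareMeasure a) := by
  have ho := isOpen_openSquare a
  rw [(hη.fderiv_apply v).integral_mul_eq, hη.integral_mul_eq]
  refine integral_mul_fderiv_eq_neg_fderiv_mul_of_integrable ?_ ?_ ?_ ?_ ?_
  · exact hη.integrable_mul ho
      ((hw.continuousOn_fderiv_of_isOpen ho le_rfl).clm_apply continuousOn_const)
  · exact (hη.fderiv_apply v).integrable_mul ho hw.continuousOn
  · exact hη.integrable_mul ho hw.continuousOn
  · intro z hz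
    exact (hw.differentiableOn (by norm_num)).differentiableAt
      (ho.mem_nhds (hη.tsupport_subset hz))
  · intro z _
    exact hη.contDiff.differentiable (by norm_num) z

end Test

/-- By continuity a violation would persist on a nonempty open set, which has positive measure. -/
lemma nonneg_of_ae_nonneg {V : Set (ℝ × ℝ)} (hV : IsOpen V) {g : ℝ × ℝ → ℝ}
    (hg : ContinuousOn g V) (h : ∀ᵐ z ∂(volume.restrict V), 0 ≤ g z) : ∀ z ∈ V, 0 ≤ g z := by
  by_contra! hne
  obtain ⟨z, hz, hlt⟩ := hne
  have ho : IsOpen (V ∩ g ⁻¹' Set.Iio 0) := hg.isOpen_inter_preimage hV isOpen_Iio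
  have hpos := ho.measure_pos volume ⟨z, hz, hlt⟩
  rw [ae_restrict_iff' hV.measurableSet] at h
  refine hpos.ne' (measure_mono_null ?_ (ae_iff.1 h))
  rintro y ⟨hy, hy'⟩ hcon
  exact absurd (hcon hy) (not_le.2 hy')

/-! ### Perturbations by test functions -/

lemma HasWeakGradient.add_test {a : ℝ} {v gx gy η : ℝ × ℝ → ℝ} (h : HasWeakGradient a v gx gy)
    (hη : IsTest (openSquare a) η) (t : ℝ) :
    HasWeakGradient a (fun z => v z + t * η z) (fun z => gx z + t * partialX η z)
      (fun z => gy z + t * partialY η z) := by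
  have aux : ∀ (g ψ : ℝ × ℝ → ℝ) (e : ℝ × ℝ), MemLp g 2 (squareMeasure a) →
      IsTest (openSquare a) ψ →
      ∫ z, v z * fderiv ℝ ψ z e ∂(squareMeasure a) = -∫ z, g z * ψ z ∂(squareMeasure a) →
      ∫ z, (v z + t * η z) * fderiv ℝ ψ z e ∂(squareMeasure a)
        = -∫ z, (g z + t * fderiv ℝ η z e) * ψ z ∂(squareMeasure a) := by
    intro g ψ e hg hψ hvg
    have hψe := hψ.fderiv_apply e
    have hηe := hη.fderiv_apply e
    have i1 : Integrable (fun z => v z * fderiv ℝ ψ z e) (squareMeasure a) :=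
      h.memLp.integrable_mul (hψe.memLp a)
    have i2 : Integrable (fun z => η z * fderiv ℝ ψ z e) (squareMeasure a) :=
      (hη.memLp a).integrable_mul (hψe.memLp a)
    have i3 : Integrable (fun z => g z * ψ z) (squareMeasure a) :=
      hg.integrable_mul (hψ.memLp a)
    have i4 : Integrable (fun z => fderiv ℝ η z e * ψ z) (squareMeasure a) :=
      (hηe.memLp a).integrable_mul (hψ.memLp a)
    simp only [add_mul, mul_assoc]
    rw [integral_add i1 (i2.const_mul t), integral_add i3 (i4.const_mul t),
      hvg, integral_const_mul, integral_const_mul,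
      hψ.integral_mul_fderiv (hη.contDiff.of_le (by norm_cast)).contDiffOn e]
    ring
  exact ⟨h.memLp.add ((hη.memLp a).const_mul t), h.memLp_x.add ((hη.partialX.memLp a).const_mul t),
    h.memLp_y.add ((hη.partialY.memLp a).const_mul t),
    fun ψ h1 h2 h3 => aux gx ψ (1, 0) h.memLp_x ⟨h1, h2, h3⟩ (h.weak_x ψ h1 h2 h3),
    fun ψ h1 h2 h3 => aux gy ψ (0, 1) h.memLp_y ⟨h1, h2, h3⟩ (h.weak_y ψ h1 h2 h3)⟩

lemma edge_notMem_openSquare (a : ℝ) (e : Fin 4) (t : ℝ) : edge a e t ∉ openSquare a := by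
  fin_cases e <;> simp [edge, openSquare]

/-- Adding the same multiple of η to the approximating functions leaves all errors unchanged, since
η vanishes on the edges. -/
lemma HasTrace.add_test {a : ℝ} {v φ η : ℝ × ℝ → ℝ} (h : HasTrace a v φ)
    (hη : IsTest (openSquare a) η) (t : ℝ) : HasTrace a (fun z => v z + t * η z) φ := by
  obtain ⟨gx, gy, hg, w, hw, h0, h1, h2, h3⟩ := h
  have hη1 : ContDiff ℝ 1 η := hη.contDiff.of_le (by norm_cast)
  have hd : ∀ k z e, fderiv ℝ (fun z => w k z + t * η z) z e
      = fderiv ℝ (w k) z e + t * fderiv ℝ η z e := by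
    intro k z e
    have e1 : DifferentiableAt ℝ (w k) z := (hw k).differentiable (by norm_num) z
    have e2 : DifferentiableAt ℝ η z := hη1.differentiable (by norm_num) z
    rw [fderiv_fun_add e1 (e2.const_mul t), fderiv_const_mul e2]
    simp
  refine ⟨_, _, hg.add_test hη t, fun k z => w k z + t * η z,
    fun k => (hw k).add (contDiff_const.mul hη1), ?_, ?_, ?_, ?_⟩
  · simpa only [add_sub_add_right_eq_sub] using h0
  · simpa only [partialX, hd, add_sub_add_right_eq_sub] using h1
  · simpa only [partialY, hd, add_sub_add_right_eq_sub] using h2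
  · intro e
    simpa only [hη.eq_zero (edge_notMem_openSquare a e _), mul_zero, add_zero] using h3 e

/-! ### The potential -/

section Potential

variable {a : ℝ} {f : ℝ × ℝ → ℝ → ℝ} (hf : IsInternalDynamics a f)

include hf

/-- Joint continuity from continuity in z and a Lipschitz bound in s uniform in z; the truncation is
there because nothing is known of f at negative s. -/
lemma IsInternalDynamics.continuousOn_uncurry :
    ContinuousOn (fun p : ℝ × (ℝ × ℝ) => f p.2 (max p.1 0)) (Set.univ ×ˢ openSquare a) := by
  obtain ⟨K, hK⟩ := hf.lipschitz
  refine continuousOn_prod_of_continuousOn_lipschitzOnWith _ K.toNNReal (fun s _ => ?_)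
    (fun z hz => ?_)
  · exact (hf.uniformContinuousOn (max s 0) (le_max_right _ _)).continuousOn
  · refine LipschitzOnWith.of_dist_le_mul fun s _ t _ => ?_
    rw [Real.dist_eq, Real.dist_eq]
    refine (hK z hz _ _ (le_max_right _ _) (le_max_right _ _)).trans ?_
    exact mul_le_mul (Real.le_coe_toNNReal K) (abs_max_sub_max_le_abs _ _ _) (abs_nonneg _)
      (by positivity)

lemma IsInternalDynamics.continuousOn_comp {v : ℝ × ℝ → ℝ} (hv : ContinuousOn v (openSquare a))
    (hv0 : ∀ z ∈ openSquare a, 0 ≤ v z) : ContinuousOn (fun z => f z (v z)) (openSquare a) := by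
  have := hf.continuousOn_uncurry.comp (hv.prodMk continuousOn_id) (fun z hz => ⟨trivial, hz⟩)
  refine this.congr fun z hz => ?_
  simp [max_eq_left (hv0 z hz)]

lemma IsInternalDynamics.continuousOn_potential {v : ℝ × ℝ → ℝ}
    (hv : ContinuousOn v (openSquare a)) (hv0 : ∀ z ∈ openSquare a, 0 ≤ v z) :
    ContinuousOn (fun z => ∫ t in (0 : ℝ)..v z, f z t) (openSquare a) := by
  rw [continuousOn_iff_continuous_domRestrict]
  have hc : Continuous (Function.uncurry fun (z : openSquare a) (t : ℝ) => f z (max t 0)) := by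
    have := hf.continuousOn_uncurry.comp_continuous
      (f := fun p : openSquare a × ℝ => (p.2, (p.1 : ℝ × ℝ))) (by fun_prop)
      (fun p => ⟨trivial, p.1.2⟩)
    exact this
  have := intervalIntegral.continuous_parametric_intervalIntegral_of_continuous (a₀ := 0)
    (μ := volume) hc (continuousOn_iff_continuous_domRestrict.1 hv)
  refine this.congr fun z => ?_
  refine intervalIntegral.integral_congr fun t ht => ?_
  rw [Set.domRestrict_apply, Set.uIcc_of_le (hv0 z z.2)] at ht
  simp only [max_eq_left ht.1]

lemma IsInternalDynamics.intervalIntegrable {z : ℝ × ℝ} (hz : z ∈ openSquare a) {s t : ℝ}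
    (hs : 0 ≤ s) (ht : 0 ≤ t) : IntervalIntegrable (f z) volume s t := by
  refine MonotoneOn.intervalIntegrable fun x hx y _ hxy => hf.monotone z hz x y ?_ hxy
  exact (le_min hs ht).trans hx.1

/-- The tangent inequality of a convex potential, with the slope taken at the new point t. -/
lemma IsInternalDynamics.potential_sub_le {z : ℝ × ℝ} (hz : z ∈ openSquare a) {s t : ℝ}
    (hs : 0 ≤ s) (ht : 0 ≤ t) :
    (∫ x in (0 : ℝ)..t, f z x) - (∫ x in (0 : ℝ)..s, f z x) ≤ f z t * (t - s) := by
  rw [intervalIntegral.integral_interval_sub_left (hf.intervalIntegrable hz le_rfl ht)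
    (hf.intervalIntegrable hz le_rfl hs)]
  rcases le_total s t with h | h
  · have := intervalIntegral.integral_mono_on h (hf.intervalIntegrable hz hs ht)
      (intervalIntegrable_const (c := f z t))
      (fun x hx => hf.monotone z hz x t (hs.trans hx.1) hx.2)
    rw [intervalIntegral.integral_const, smul_eq_mul] at this
    linarith
  · have := intervalIntegral.integral_mono_on h (intervalIntegrable_const (c := f z t))
      (hf.intervalIntegrable hz ht hs)
      (fun x hx => hf.monotone z hz t x ht hx.1)
    rw [intervalIntegral.integral_const, smul_eq_mul] at this
    rw [intervalIntegral.integral_symm]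
    linarith

lemma IsInternalDynamics.abs_potential_le {z : ℝ × ℝ} (hz : z ∈ openSquare a) {R K t : ℝ}
    (hK0 : 0 ≤ K) (hK : ∀ s, 0 ≤ s → s ≤ R → f z s ≤ K) (ht : 0 ≤ t) (htR : t ≤ R) :
    |∫ x in (0 : ℝ)..t, f z x| ≤ K * R := by
  have h1 := hf.potential_sub_le hz le_rfl ht
  rw [intervalIntegral.integral_same, sub_zero, sub_zero] at h1
  have h2 : 0 ≤ ∫ x in (0 : ℝ)..t, f z x :=
    intervalIntegral.integral_nonneg ht fun x hx => hf.nonneg hz hx.1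
  rw [abs_of_nonneg h2]
  exact h1.trans (mul_le_mul (hK t ht htR) htR ht hK0)

lemma IsInternalDynamics.integrable_energy_density {v gx gy : ℝ × ℝ → ℝ}
    (hg : HasWeakGradient a v gx gy) (hv : ContinuousOn v (openSquare a))
    (hv0 : ∀ z ∈ openSquare a, 0 ≤ v z) {R : ℝ} (hvR : ∀ z ∈ openSquare a, v z ≤ R) :
    Integrable (fun z => (1 / 2 : ℝ) * (gx z ^ 2 + gy z ^ 2) + ∫ t in (0 : ℝ)..v z, f z t)
      (squareMeasure a) := by
  refine ((hg.memLp_x.integrable_sq.add hg.memLp_y.integrable_sq).const_mul _).add ?_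
  obtain ⟨K, hK0, hK⟩ := hf.exists_bound R
  have hm := (isOpen_openSquare a).measurableSet
  have hfin : volume (openSquare a) < ⊤ :=
    (measure_mono (openSquare_subset_closedSquare a)).trans_lt
      (isCompact_closedSquare a).measure_lt_top
  have : IsFiniteMeasure (squareMeasure a) := ⟨by simpa [squareMeasure] using hfin⟩
  refine Integrable.of_bound ((hf.continuousOn_potential hv hv0).aestronglyMeasurable hm)
    (K * R) ?_
  refine (ae_restrict_iff' hm).2 (Filter.Eventually.of_forall fun z hz => ?_)
  exact hf.abs_potential_le hz hK0 (hK z hz) (hv0 z hz) (hvR z hz)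

end Potential

/-! ### The Euler–Lagrange equation -/

lemma eq_zero_of_forall_nonneg_add_sq {A B t₀ : ℝ} (ht₀ : 0 < t₀)
    (h : ∀ t, |t| ≤ t₀ → 0 ≤ t * A + t ^ 2 * B) : A = 0 := by
  have key : ∀ A : ℝ, (∀ t, 0 < t → t ≤ t₀ → 0 ≤ t * A + t ^ 2 * B) → 0 ≤ A := by
    intro A hA
    by_contra! hneg
    have hB : 0 < |B| + 1 := by positivity
    set t := min t₀ (-A / (2 * (|B| + 1))) with ht
    have htpos : 0 < t := lt_min ht₀ (div_pos (by linarith) (by positivity))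
    have h1 := hA t htpos (min_le_left _ _)
    have h2 : t * (2 * (|B| + 1)) ≤ -A := (le_div_iff₀ (by positivity)).1 (min_le_right _ _)
    have h3 : B ≤ |B| := le_abs_self B
    have h4 : 0 ≤ A + t * B := by
      by_contra! hc
      nlinarith
    nlinarith
  refine le_antisymm ?_ (key A fun t h1 h2 => h t (by rwa [abs_of_pos h1]))
  have := key (-A) fun t h1 h2 => by
    have := h (-t) (by rwa [abs_neg, abs_of_pos h1])
    linarith
  linarith

lemma lap_eq_zero_of_eventuallyEq {w : ℝ × ℝ → ℝ} {z : ℝ × ℝ} (h : w =ᶠ[nhds z] 0) :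
    lap w z = 0 := by
  have hx : partialX w =ᶠ[nhds z] 0 := by
    filter_upwards [h.fderiv (𝕜 := ℝ)] with y hy
    simp [partialX, hy]
  have hy : partialY w =ᶠ[nhds z] 0 := by
    filter_upwards [h.fderiv (𝕜 := ℝ)] with y hy
    simp [partialY, hy]
  unfold lap
  rw [partialX, partialY, hx.fderiv_eq, hy.fderiv_eq]
  simp

section EulerLagrange

variable {m : ℕ} {a : ℝ} {f : Fin m → ℝ × ℝ → ℝ → ℝ} {φ u : Fin m → ℝ × ℝ → ℝ}

/-- The positivity set of a component. -/
def positivitySet (a : ℝ) (w : ℝ × ℝ → ℝ) : Set (ℝ × ℝ) := openSquare a ∩ w ⁻¹' Set.Ioi 0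

lemma isOpen_positivitySet {w : ℝ × ℝ → ℝ} (hw : ContinuousOn w (openSquare a)) :
    IsOpen (positivitySet a w) := hw.isOpen_inter_preimage (isOpen_openSquare a) isOpen_Ioi

lemma IsAdmissible.isSegregated (hu : IsAdmissible a φ u)
    (hc : ∀ l, ContinuousOn (u l) (openSquare a)) {z : ℝ × ℝ} (hz : z ∈ openSquare a) :
    IsSegregated fun l => u l z := by
  refine ⟨fun l => nonneg_of_ae_nonneg (isOpen_openSquare a) (hc l) (hu.nonneg l) z hz,
    fun l p hlp => ?_⟩
  have h := hu.segregated l p hlp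
  have h1 := nonneg_of_ae_nonneg (isOpen_openSquare a) ((hc l).mul (hc p))
    (h.mono fun z hz => hz.ge) z hz
  have h2 := nonneg_of_ae_nonneg (isOpen_openSquare a) ((hc l).mul (hc p)).neg
    (h.mono fun z hz => by simp [hz]) z hz
  simp only [Pi.mul_apply, Pi.neg_apply] at h1 h2
  linarith

lemma forall_update {P : Fin m → (ℝ × ℝ → ℝ) → Prop} {l : Fin m} {w : ℝ × ℝ → ℝ}
    (hl : P l w) (h : ∀ p, p ≠ l → P p (u p)) (p : Fin m) : P p (Function.update u l w p) := by
  by_cases hp : p = l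
  · subst hp
    rwa [Function.update_self]
  · rw [Function.update_of_ne hp]
    exact h p hp

/-- The perturbation lives where `u l` is positive, hence where all other components vanish, so
segregation survives. -/
lemma IsAdmissible.update_add_test (hu : IsAdmissible a φ u)
    (hc : ∀ l, ContinuousOn (u l) (openSquare a)) {l : Fin m} {η : ℝ × ℝ → ℝ}
    (hη : IsTest (positivitySet a (u l)) η) {t : ℝ}
    (hpos : ∀ z ∈ openSquare a, 0 ≤ u l z + t * η z) :
    IsAdmissible a φ (Function.update u l fun z => u l z + t * η z) := by
  have hη' : IsTest (openSquare a) η := hη.mono Set.inter_subset_left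
  have hm := (isOpen_openSquare a).measurableSet
  have hs : ∀ q, q ≠ l → ∀ z ∈ openSquare a, (u l z + t * η z) * u q z = 0 := by
    intro q hq z hz
    have hz' := hu.isSegregated hc hz
    by_cases hp : 0 < u l z
    · rw [show u q z = 0 from hz'.eq_zero_of_pos hp hq, mul_zero]
    · rw [hη.eq_zero (fun h => hp h.2), le_antisymm (not_lt.1 hp) (hz'.nonneg l)]
      simp
  refine ⟨?_, ?_, ?_, ?_⟩
  · refine forall_update (P := fun _ w => ∃ gx gy, HasWeakGradient a w gx gy) ?_
      fun p _ => hu.sobolev p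
    obtain ⟨gx, gy, hg⟩ := hu.sobolev l
    exact ⟨_, _, hg.add_test hη' t⟩
  · exact forall_update (P := fun _ w => ∀ᵐ z ∂(squareMeasure a), 0 ≤ w z)
      (ae_restrict_of_forall_mem hm hpos) fun p _ => hu.nonneg p
  · intro p q hpq
    by_cases hp : p = l
    · subst hp
      rw [Function.update_self, Function.update_of_ne hpq.symm]
      exact ae_restrict_of_forall_mem hm (hs q hpq.symm)
    · by_cases hq : q = l
      · subst hq
        rw [Function.update_self, Function.update_of_ne hp]
        exact ae_restrict_of_forall_mem hm fun z hz => by rw [mul_comm]; exact hs p hp z hz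
      · rw [Function.update_of_ne hp, Function.update_of_ne hq]
        exact hu.segregated p q hpq
  · exact forall_update (P := fun p w => HasTrace a w (φ p)) ((hu.trace l).add_test hη' t)
      fun p _ => hu.trace p

/-- On the positivity set of a component the other components have vanishing Laplacian. -/
lemma IsMinimizer.lap_eq_zero_of_pos (hu : IsMinimizer a f φ u)
    (hc : ∀ l, ContinuousOn (u l) (openSquare a)) {l p : Fin m} (hlp : p ≠ l) {z : ℝ × ℝ}
    (hz : z ∈ openSquare a) (hpos : 0 < u l z) : lap (u p) z = 0 := by
  refine lap_eq_zero_of_eventuallyEq ?_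
  filter_upwards [(isOpen_positivitySet (hc l)).mem_nhds ⟨hz, hpos⟩] with y hy
  exact (hu.1.isSegregated hc hy.1).eq_zero_of_pos hy.2 hlp

variable (hf : ∀ l, IsInternalDynamics a (f l)) (hu : IsMinimizer a f φ u)
  (hc : ∀ l, ContinuousOn (u l) (openSquare a))
  (hb : ∀ l, ∃ R, ∀ z ∈ openSquare a, u l z ≤ R)

include hf hu hc hb

/-- The first variation without differentiating under the integral: convexity of the potential and
the Lipschitz bound on f estimate the energy increment by tA + t²B for small t of either sign, so
the linear coefficient vanishes. -/
lemma IsMinimizer.integral_test_eq_zero {ux uy : Fin m → ℝ × ℝ → ℝ}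
    (hg : ∀ l, HasWeakGradient a (u l) (ux l) (uy l)) {l : Fin m} {η : ℝ × ℝ → ℝ}
    (hη : IsTest (positivitySet a (u l)) η) :
    ∫ z, (ux l z * partialX η z + uy l z * partialY η z + f l z (u l z) * η z)
      ∂(squareMeasure a) = 0 := by
  have hm := (isOpen_openSquare a).measurableSet
  have hη' : IsTest (openSquare a) η := hη.mono Set.inter_subset_left
  have hseg : ∀ z ∈ openSquare a, IsSegregated fun l => u l z := fun z hz =>
    hu.1.isSegregated hc hz
  obtain ⟨K₀, hK₀⟩ := (hf l).lipschitz
  set K := |K₀| with hKdef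
  obtain ⟨H, hH⟩ := hη.hasCompactSupport.exists_bound_of_continuous hη.continuous
  have hH0 : 0 ≤ H := (norm_nonneg _).trans (hH 0)
  choose R hR using hb
  -- The positive minimum of `u l` on the compact support of η leaves room for perturbations with
  -- |t| ≤ c/(H+1).
  obtain ⟨c, hc0, hcle⟩ : ∃ c > 0, ∀ z ∈ tsupport η, c ≤ u l z := by
    rcases (tsupport η).eq_empty_or_nonempty with he | hne
    · exact ⟨1, one_pos, by simp [he]⟩
    · obtain ⟨z₀, hz₀, hmin⟩ := hη.hasCompactSupport.isCompact.exists_isMinOn hne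
        ((hc l).mono hη'.tsupport_subset)
      exact ⟨u l z₀, (hη.tsupport_subset hz₀).2, fun z hz => hmin hz⟩
  have hpos : ∀ t : ℝ, |t| ≤ c / (H + 1) → ∀ z ∈ openSquare a, 0 ≤ u l z + t * η z := by
    intro t ht z hz
    by_cases hzs : z ∈ tsupport η
    · have h1 : |t| * (H + 1) ≤ c := (le_div_iff₀ (by positivity)).1 ht
      have h2 : |t * η z| ≤ |t| * (H + 1) := by
        rw [abs_mul]
        have := hH z
        rw [Real.norm_eq_abs] at this
        gcongr
        linarith
      linarith [(abs_le.1 h2).1, hcle z hzs]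
    · rw [image_eq_zero_of_notMem_tsupport hzs, mul_zero, add_zero]
      exact (hseg z hz).nonneg l
  set A : ℝ × ℝ → ℝ := fun z =>
    ux l z * partialX η z + uy l z * partialY η z + f l z (u l z) * η z with hA
  set B : ℝ × ℝ → ℝ := fun z =>
    1 / 2 * (partialX η z ^ 2 + partialY η z ^ 2) + K * η z ^ 2 with hB
  have iA : Integrable A (squareMeasure a) := by
    refine (Integrable.add ?_ ?_).add ?_
    · exact (hg l).memLp_x.integrable_mul (hη'.partialX.memLp a)
    · exact (hg l).memLp_y.integrable_mul (hη'.partialY.memLp a)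
    · exact (hη'.integrable_mul (isOpen_openSquare a)
        ((hf l).continuousOn_comp (hc l) fun z hz => (hseg z hz).nonneg l)).integrableOn
  have iB : Integrable B (squareMeasure a) :=
    (((hη'.partialX.memLp a).integrable_sq.add (hη'.partialY.memLp a).integrable_sq).const_mul
      _).add ((hη'.memLp a).integrable_sq.const_mul K)
  have iu : ∀ p, Integrable (fun z => (1 / 2 : ℝ) * (ux p z ^ 2 + uy p z ^ 2)
      + ∫ t in (0 : ℝ)..u p z, f p z t) (squareMeasure a) := fun p =>
    (hf p).integrable_energy_density (hg p) (hc p) (fun z hz => (hseg z hz).nonneg p) (hR p)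
  refine eq_zero_of_forall_nonneg_add_sq (B := ∫ z, B z ∂(squareMeasure a))
    (t₀ := c / (H + 1)) (by positivity) fun t ht => ?_
  set v := Function.update u l fun z => u l z + t * η z with hv
  set vx := Function.update ux l fun z => ux l z + t * partialX η z with hvx
  set vy := Function.update uy l fun z => uy l z + t * partialY η z with hvy
  have hvg : ∀ p, HasWeakGradient a (v p) (vx p) (vy p) := by
    intro p
    by_cases hp : p = l
    · subst hp
      simp only [hv, hvx, hvy, Function.update_self]
      exact (hg p).add_test hη' t
    · simp only [hv, hvx, hvy, Function.update_of_ne hp]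
      exact hg p
  have hmin := hu.2 v (hu.1.update_add_test hc hη (hpos t ht)) ux uy vx vy hg hvg
  have iv : ∀ p, Integrable (fun z => (1 / 2 : ℝ) * (vx p z ^ 2 + vy p z ^ 2)
      + ∫ t in (0 : ℝ)..v p z, f p z t) (squareMeasure a) := by
    intro p
    by_cases hp : p = l
    · subst hp
      refine (hf p).integrable_energy_density (hvg p) (R := R p + |t| * H) ?_ ?_ ?_
      · simp only [hv, Function.update_self]
        exact (hc p).add (hη.continuous.continuousOn.const_smul t)
      · simp only [hv, Function.update_self]
        exact hpos t ht
      · simp only [hv, Function.update_self]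
        intro z hz
        have h1 : |t * η z| ≤ |t| * H := by
          rw [abs_mul]
          gcongr
          exact hH z
        exact add_le_add (hR p z hz) ((le_abs_self _).trans h1)
    · simp only [hv, hvx, hvy, Function.update_of_ne hp]
      exact iu p
  have hle : energy a f v vx vy ≤ ∫ z, ((∑ p, ((1 / 2 : ℝ) * (ux p z ^ 2 + uy p z ^ 2)
      + ∫ s in (0 : ℝ)..u p z, f p z s)) + (t * A z + t ^ 2 * B z)) ∂(squareMeasure a) := by
    refine integral_mono_ae (integrable_finsetSum _ fun p _ => iv p)
      ((integrable_finsetSum _ fun p _ => iu p).add ((iA.const_mul t).add (iB.const_mul _))) ?_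
    refine ae_restrict_of_forall_mem hm fun z hz => ?_
    have hrest : ∑ p ∈ Finset.univ.erase l, ((1 / 2 : ℝ) * (vx p z ^ 2 + vy p z ^ 2)
        + ∫ s in (0 : ℝ)..v p z, f p z s) = ∑ p ∈ Finset.univ.erase l,
        ((1 / 2 : ℝ) * (ux p z ^ 2 + uy p z ^ 2) + ∫ s in (0 : ℝ)..u p z, f p z s) := by
      refine Finset.sum_congr rfl fun p hp => ?_
      simp only [hv, hvx, hvy, Function.update_of_ne (Finset.ne_of_mem_erase hp)]
    simp only
    rw [← Finset.add_sum_erase _ _ (Finset.mem_univ l),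
      ← Finset.add_sum_erase (a := l) _ (fun p => (1 / 2 : ℝ) * (ux p z ^ 2 + uy p z ^ 2)
        + ∫ s in (0 : ℝ)..u p z, f p z s) (Finset.mem_univ l), hrest]
    simp only [hv, hvx, hvy, Function.update_self]
    have h0 := (hseg z hz).nonneg l
    have h1 := hpos t ht z hz
    have h2 := (hf l).potential_sub_le hz h0 h1
    have h3 : (f l z (u l z + t * η z) - f l z (u l z)) * (t * η z) ≤ K * (t * η z) ^ 2 := by
      refine (le_abs_self _).trans ?_
      rw [abs_mul, ← sq_abs (t * η z), sq, ← mul_assoc]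
      gcongr
      refine (hK₀ z hz _ _ h1 h0).trans ?_
      rw [add_sub_cancel_left]
      gcongr
      exact le_abs_self K₀
    simp only [hA, hB]
    rw [add_sub_cancel_left] at h2
    linarith
  have iAB : Integrable (fun z => t * A z + t ^ 2 * B z) (squareMeasure a) :=
    (iA.const_mul t).add (iB.const_mul _)
  rw [integral_add (integrable_finsetSum _ fun p _ => iu p) iAB, integral_add (iA.const_mul t) (iB.const_mul _),
    integral_const_mul, integral_const_mul] at hle
  have := hmin.trans hle
  unfold energy at this
  linarith

variable (hC2 : ∀ l, ContDiffOn ℝ 2 (u l) (openSquare a))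

include hC2

/-- The Euler–Lagrange equation on the positivity set. -/
lemma IsMinimizer.lap_eq_of_pos {l : Fin m} {z : ℝ × ℝ} (hz : z ∈ openSquare a)
    (hpos : 0 < u l z) : lap (u l) z = f l z (u l z) := by
  have ho := isOpen_openSquare a
  have hV := isOpen_positivitySet (hc l)
  have hsub : positivitySet a (u l) ⊆ openSquare a := Set.inter_subset_left
  have hcf := (hf l).continuousOn_comp (hc l)
    fun z hz => (hu.1.isSegregated hc hz).nonneg l
  have hcd : ContinuousOn (fun z => f l z (u l z) - lap (u l) z) (positivitySet a (u l)) :=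
    (hcf.sub (continuousOn_lap (hC2 l))).mono hsub
  have hae := hV.ae_eq_zero_of_integral_contDiff_smul_eq_zero (μ := volume)
    (hcd.locallyIntegrableOn hV.measurableSet) (fun η h1 h2 h3 => by
      have hη : IsTest (positivitySet a (u l)) η := ⟨h1, h2, h3⟩
      have hη' := hη.mono hsub
      choose ux uy hg using hu.1.sobolev
      have key := hu.integral_test_eq_zero hf hc hb hg hη
      have hw1 : ContDiffOn ℝ 1 (u l) (openSquare a) := (hC2 l).of_le (by norm_num)
      -- The weak derivative is tested with `partialX η`, and two classical integrations by parts
      -- evaluate the same integral, so weak and classical gradients need not be identified.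
      have ex : ∫ z, ux l z * partialX η z ∂(squareMeasure a)
          = -∫ z, partialX (partialX (u l)) z * η z ∂(squareMeasure a) := by
        have e1 := (hg l).weak_x _ hη'.partialX.1 hη'.partialX.2 hη'.partialX.3
        have e2 := hη'.partialX.integral_mul_fderiv hw1 (1, 0)
        have e3 := hη'.integral_mul_fderiv (contDiffOn_partialX (n := 1) (hC2 l)) (1, 0)
        simp only [partialX] at e1 e2 e3 ⊢
        linarith
      have ey : ∫ z, uy l z * partialY η z ∂(squareMeasure a)
          = -∫ z, partialY (partialY (u l)) z * η z ∂(squareMeasure a) := by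
        have e1 := (hg l).weak_y _ hη'.partialY.1 hη'.partialY.2 hη'.partialY.3
        have e2 := hη'.partialY.integral_mul_fderiv hw1 (0, 1)
        have e3 := hη'.integral_mul_fderiv (contDiffOn_partialY (n := 1) (hC2 l)) (0, 1)
        simp only [partialY] at e1 e2 e3 ⊢
        linarith
      have i1 : Integrable (fun z => ux l z * partialX η z) (squareMeasure a) :=
        (hg l).memLp_x.integrable_mul (hη'.partialX.memLp a)
      have i2 : Integrable (fun z => uy l z * partialY η z) (squareMeasure a) :=
        (hg l).memLp_y.integrable_mul (hη'.partialY.memLp a)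
      have i3 : Integrable (fun z => f l z (u l z) * η z) (squareMeasure a) :=
        (hη'.integrable_mul ho hcf).integrableOn
      have i4 : Integrable (fun z => partialX (partialX (u l)) z * η z) (squareMeasure a) :=
        (hη'.integrable_mul ho (continuousOn_partialX_partialX (hC2 l))).integrableOn
      have i5 : Integrable (fun z => partialY (partialY (u l)) z * η z) (squareMeasure a) :=
        (hη'.integrable_mul ho (continuousOn_partialY_partialY (hC2 l))).integrableOn
      have i12 : Integrable (fun z => ux l z * partialX η z + uy l z * partialY η z)
          (squareMeasure a) := i1.add i2
      have i45 : Integrable (fun z => partialX (partialX (u l)) z * η z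
          + partialY (partialY (u l)) z * η z) (squareMeasure a) := i4.add i5
      rw [integral_add i12 i3, integral_add i1 i2, ex, ey] at key
      have e : ∫ z, η z • (f l z (u l z) - lap (u l) z)
          = ∫ z, (f l z (u l z) - lap (u l) z) * η z ∂(squareMeasure a) := by
        rw [hη'.integral_mul_eq]
        simp only [smul_eq_mul, mul_comm]
      rw [e]
      have e' : ∀ z, (f l z (u l z) - lap (u l) z) * η z = f l z (u l z) * η z
          - (partialX (partialX (u l)) z * η z + partialY (partialY (u l)) z * η z) := by
        intro z
        unfold lap
        ring
      simp only [e']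
      rw [integral_sub i3 i45, integral_add i4 i5]
      linarith)
  rw [← ae_restrict_iff' hV.measurableSet] at hae
  have h1 := nonneg_of_ae_nonneg hV hcd (hae.mono fun z hz => hz.ge) z ⟨hz, hpos⟩
  have h2 := nonneg_of_ae_nonneg hV hcd.neg (hae.mono fun z hz => by simp [hz]) z ⟨hz, hpos⟩
  simp only [Pi.neg_apply] at h2
  linarith

/-- Every component is a subsolution of the Euler–Lagrange equation. -/
lemma IsMinimizer.lap_le (l : Fin m) {z : ℝ × ℝ} (hz : z ∈ openSquare a) :
    lap (u l) z ≤ f l z (u l z) := by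
  by_contra! hlt
  have ho := isOpen_openSquare a
  have h0 : ∀ z ∈ openSquare a, 0 ≤ u l z := fun z hz => (hu.1.isSegregated hc hz).nonneg l
  have hcd : ContinuousOn (fun z => lap (u l) z - f l z (u l z)) (openSquare a) :=
    (continuousOn_lap (hC2 l)).sub ((hf l).continuousOn_comp (hc l) h0)
  have hev := (hcd.continuousAt (ho.mem_nhds hz)).eventually_const_lt
    (show (0 : ℝ) < lap (u l) z - f l z (u l z) by linarith)
  -- The strict inequality persists near z and contradicts the equation at positive values, so `u l`
  -- vanishes near z; then its Laplacian is 0, at most f.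
  have hzero : u l =ᶠ[nhds z] 0 := by
    filter_upwards [hev, ho.mem_nhds hz] with y hy hyo
    refine le_antisymm ?_ (h0 y hyo)
    by_contra! hp
    have := hu.lap_eq_of_pos hf hc hb hC2 hyo hp
    linarith
  rw [lap_eq_zero_of_eventuallyEq hzero] at hlt
  linarith [(hf l).nonneg hz (h0 z hz)]

end EulerLagrange

/-! ### Convergence -/

/-- Each property holds for all small r, so one r serves the whole finite family. -/
lemma exists_pos_forall {ι : Type*} [Finite ι] {P : ι → ℝ → Prop}
    (hP : ∀ l, ∃ r₀ > 0, ∀ r, 0 < r → r ≤ r₀ → P l r) : ∃ r > 0, ∀ l, P l r := by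
  have h : ∀ᶠ r in nhdsWithin (0 : ℝ) (Set.Ioi 0), ∀ l, P l r := by
    refine Filter.eventually_all.2 fun l => ?_
    obtain ⟨r₀, h0, hr⟩ := hP l
    filter_upwards [Ioc_mem_nhdsGT h0] with r h using hr r h.1 h.2
  obtain ⟨r, h1, h2⟩ := (h.and self_mem_nhdsWithin).exists
  exact ⟨r, h2, h1⟩

lemma abs_hat_sub_hat_le {m : ℕ} {v w : Fin m → ℝ} {ε : ℝ} (h : ∀ p, |v p - w p| ≤ ε)
    (l : Fin m) : |hat v l - hat w l| ≤ m * ε := by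
  have e1 : hat v l - hat w l = (v l - w l) - ∑ p ∈ Finset.univ.erase l, (v p - w p) := by
    unfold hat
    rw [Finset.sum_sub_distrib]
    ring
  have e2 : ∑ _p : Fin m, ε = m * ε := by simp
  rw [e1, ← e2, ← Finset.add_sum_erase _ _ (Finset.mem_univ l)]
  refine (abs_sub _ _).trans (add_le_add (h l) ?_)
  exact (Finset.abs_sum_le_sum_abs _ _).trans (Finset.sum_le_sum fun p _ => h p)

lemma continuousOn_hat {m : ℕ} {u : Fin m → ℝ × ℝ → ℝ} {s : Set (ℝ × ℝ)}
    (hu : ∀ l, ContinuousOn (u l) s) (l : Fin m) :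
    ContinuousOn (fun z => hat (fun l => u l z) l) s :=
  (hu l).sub (continuousOn_finsetSum _ fun p _ => hu p)

section Convergence

variable {m : ℕ} {a : ℝ} {f : Fin m → ℝ × ℝ → ℝ → ℝ} {φ u : Fin m → ℝ × ℝ → ℝ}

/-- Solutions of the scheme attain their boundary values uniformly with respect to the mesh. -/
lemma exists_abs_sub_le_near_boundary (ha : 0 < a) (hf : ∀ l, IsInternalDynamics a (f l))
    (hφ : ∀ l, ∀ z ∈ squareBoundary a, 0 ≤ φ l z)
    (hφs : ∀ l p, l ≠ p → ∀ z ∈ squareBoundary a, φ l z * φ p z = 0)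
    (hu_cont : ∀ l, ContinuousOn (u l) (closedSquare a))
    (hu_bd : ∀ l, ∀ z ∈ squareBoundary a, u l z = φ l z) {ε : ℝ} (hε : 0 < ε) :
    ∃ ρ > 0, ∀ l, ∀ N : ℕ, 0 < N → ∀ U, IsSchemeSolution a N f φ U →
      ∀ i j : ℤ, 0 ≤ i → i ≤ N → 0 ≤ j → j ≤ N →
        ¬ ((i : ℝ) * (a / N) ∈ Set.Icc ρ (a - ρ) ∧ (j : ℝ) * (a / N) ∈ Set.Icc ρ (a - ρ)) →
        |U l i j - u l (gridPoint a N i j)| ≤ ε := by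
  have hsub : squareBoundary a ⊆ closedSquare a := Set.sdiff_subset
  refine exists_pos_forall fun l => ?_
  obtain ⟨M, hM⟩ := (isCompact_closedSquare a).exists_bound_of_continuousOn (hu_cont l)
  obtain ⟨K, hK0, hK⟩ := (hf l).exists_bound (M + 2 * a ^ 2)
  obtain ⟨C₁, hC₁0, hC₁⟩ := exists_abs_sub_le_add_mul_sq (isCompact_closedSquare a) (hu_cont l)
    (show 0 < ε / 4 by positivity)
  obtain ⟨C₂, hC₂0, hC₂⟩ := exists_abs_sub_le_add_mul_sq (isCompact_closedSquare a)
    (continuousOn_hat hu_cont l) (show 0 < ε / 4 by positivity)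
  set C := max C₁ C₂ with hC
  have hC0 : 0 ≤ C := hC₁0.trans (le_max_left _ _)
  set A := 2 * C + (2 * C + K + 1) * a with hA
  have hA0 : 0 < A := by positivity
  -- Two quadratic terms, each at most Cρ² ≤ Cρ as ρ ≤ 1, and q ≤ aρ add up to Aρ ≤ ε/2; the two
  -- tolerances ε/4 make up the rest.
  refine ⟨min 1 (ε / 2 / A), by positivity, fun ρ hρ0 hρ N hN U hU i j hi hi' hj hj' hn => ?_⟩
  have hρ1 : ρ ≤ 1 := hρ.trans (min_le_left _ _)
  have hρA : ρ * A ≤ ε / 2 := (le_div_iff₀ hA0).1 (hρ.trans (min_le_right _ _))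
  have hsol : ∀ i j : ℤ, 1 ≤ i → i ≤ N - 1 → 1 ≤ j → j ≤ N - 1 →
      f l (gridPoint a N i j) (U l i j) ≤ K := by
    intro i j h1 h2 h3 h4
    refine hK _ (gridPoint_mem_openSquare ha hN h1 h2 h3 h4) _
      (hU.nonneg ha hN hφ l (by omega) (by omega) (by omega) (by omega)) ?_
    refine hU.le_of_boundary_le ha hN hf hφ hφs l (fun z hz => ?_)
      (by omega) (by omega) (by omega) (by omega)
    rw [← hu_bd l z hz]
    exact (le_abs_self _).trans (hM z (hsub hz))
  -- Applied with z₀ the projection of the mesh point onto a nearby side and q the parabola t(a - t)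
  -- in the normal variable.
  have core : ∀ (z₀ : ℝ × ℝ) (q : ℤ → ℤ → ℝ), z₀ ∈ squareBoundary a →
      (∀ i j : ℤ, 0 ≤ i → i ≤ N → 0 ≤ j → j ≤ N → 0 ≤ q i j) →
      (∀ i j : ℤ, neighbourAverage q i j = q i j - (a / N) ^ 2 / 2) →
      meshSqDist a N z₀ i j ≤ ρ ^ 2 → q i j ≤ a * ρ →
      |U l i j - u l (gridPoint a N i j)| ≤ ε := by
    intro z₀ q hz₀ hq0 hq hd hqρ
    have h1 := hU.abs_sub_le_barrier ha hN hf hφ hφs hu_bd l (ε := ε / 4) (C := C) hz₀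
      (fun z hz => (hC₁ z (hsub hz) z₀ (hsub hz₀)).trans (by gcongr; exact le_max_left _ _))
      (fun z hz => (hC₂ z (hsub hz) z₀ (hsub hz₀)).trans (by gcongr; exact le_max_right _ _))
      hsol hC0 hK0 hq0 hq hi hi' hj hj'
    have h2 : |u l (gridPoint a N i j) - u l z₀| ≤ ε / 4 + C * meshSqDist a N z₀ i j :=
      (hC₁ _ (gridPoint_mem_closedSquare ha hN hi hi' hj hj') z₀ (hsub hz₀)).trans (by
        unfold meshSqDist gridPoint
        gcongr
        exact le_max_left _ _)
    have h3 : C * meshSqDist a N z₀ i j ≤ C * ρ := by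
      gcongr
      nlinarith
    have h4 : (2 * C + K + 1) * q i j ≤ (2 * C + K + 1) * (a * ρ) := by gcongr
    have h5 := abs_sub_le (U l i j) (u l z₀) (u l (gridPoint a N i j))
    rw [abs_sub_comm (u l z₀)] at h5
    rw [hA] at hρA
    linarith
  obtain ⟨x0, x1⟩ := mul_div_mem_Icc ha hN hi hi'
  obtain ⟨y0, y1⟩ := mul_div_mem_Icc ha hN hj hj'
  have qx0 : ∀ i j : ℤ, 0 ≤ i → i ≤ N → 0 ≤ j → j ≤ N →
      0 ≤ (i : ℝ) * (a / N) * (a - i * (a / N)) := fun i j h1 h2 _ _ => by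
    obtain ⟨k1, k2⟩ := mul_div_mem_Icc ha hN h1 h2
    exact mul_nonneg k1 (by linarith)
  have qy0 : ∀ i j : ℤ, 0 ≤ i → i ≤ N → 0 ≤ j → j ≤ N →
      0 ≤ (j : ℝ) * (a / N) * (a - j * (a / N)) := fun i j _ _ h1 h2 => by
    obtain ⟨k1, k2⟩ := mul_div_mem_Icc ha hN h1 h2
    exact mul_nonneg k1 (by linarith)
  have qx : ∀ i j : ℤ, neighbourAverage
      (fun i _ => (i : ℝ) * (a / N) * (a - i * (a / N))) i j
        = (i : ℝ) * (a / N) * (a - i * (a / N)) - (a / N) ^ 2 / 2 := fun i j => by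
    unfold neighbourAverage
    push_cast
    ring
  have qy : ∀ i j : ℤ, neighbourAverage
      (fun _ j => (j : ℝ) * (a / N) * (a - j * (a / N))) i j
        = (j : ℝ) * (a / N) * (a - j * (a / N)) - (a / N) ^ 2 / 2 := fun i j => by
    unfold neighbourAverage
    push_cast
    ring
  have hcases : (i : ℝ) * (a / N) < ρ ∨ a - ρ < i * (a / N) ∨ (j : ℝ) * (a / N) < ρ ∨
      a - ρ < j * (a / N) := by
    by_contra! hcon
    exact hn ⟨⟨hcon.1, hcon.2.1⟩, hcon.2.2.1, hcon.2.2.2⟩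
  have hsq : ∀ x, 0 ≤ x → x < ρ → x ^ 2 ≤ ρ ^ 2 := fun x h1 h2 => pow_le_pow_left₀ h1 h2.le 2
  rcases hcases with h | h | h | h
  · refine core (0, j * (a / N)) _ ⟨⟨⟨le_rfl, ha.le⟩, y0, y1⟩, fun hz => hz.1.1.false⟩ qx0 qx ?_ ?_
    · simpa [meshSqDist] using hsq _ x0 h
    · nlinarith
  · refine core (a, j * (a / N)) _ ⟨⟨⟨ha.le, le_rfl⟩, y0, y1⟩, fun hz => hz.1.2.false⟩ qx0 qx ?_ ?_
    · have := hsq (a - i * (a / N)) (by linarith) (by linarith)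
      simp only [meshSqDist, sub_self]
      linarith
    · nlinarith
  · refine core (i * (a / N), 0) _ ⟨⟨⟨x0, x1⟩, le_rfl, ha.le⟩, fun hz => hz.2.1.false⟩ qy0 qy ?_ ?_
    · simpa [meshSqDist] using hsq _ y0 h
    · nlinarith
  · refine core (i * (a / N), a) _ ⟨⟨⟨x0, x1⟩, ha.le, le_rfl⟩, fun hz => hz.2.2.false⟩ qy0 qy ?_ ?_
    · have := hsq (a - j * (a / N)) (by linarith) (by linarith)
      simp only [meshSqDist, sub_self]
      linarith
    · nlinarith

end Convergence

end Segregation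

/-! ### The convergence theorem -/

open Segregation in
theorem corollary4p2 {m : ℕ} (a : ℝ) (ha : 0 < a)
    (f : Fin m → ℝ × ℝ → ℝ → ℝ) (hf : ∀ l, Segregation.IsInternalDynamics a (f l))
    (φ : Fin m → ℝ × ℝ → ℝ)
    (hφ_nonneg : ∀ l, ∀ z ∈ Segregation.squareBoundary a, 0 ≤ φ l z)
    (hφ_segregated : ∀ l p, l ≠ p → ∀ z ∈ Segregation.squareBoundary a, φ l z * φ p z = 0)
    (u : Fin m → ℝ × ℝ → ℝ)
    (hu_min : Segregation.IsMinimizer a f φ u)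
    (hu_C2 : ∀ l, ContDiffOn ℝ 2 (u l) (Segregation.openSquare a))
    (hu_cont : ∀ l, ContinuousOn (u l) (Segregation.closedSquare a))
    (hu_boundary : ∀ l, ∀ z ∈ Segregation.squareBoundary a, u l z = φ l z) :
    ∀ ε : ℝ, 0 < ε → ∃ N₀ : ℕ, ∀ N : ℕ, N₀ ≤ N →
      ∀ U : Fin m → ℤ → ℤ → ℝ, Segregation.IsSchemeSolution a N f φ U →
        ∀ l, ∀ i j : ℤ, 0 ≤ i → i ≤ N → 0 ≤ j → j ≤ N →
          |U l i j - u l (Segregation.gridPoint a N i j)| < ε := by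
  intro ε hε
  have hc : ∀ l, ContinuousOn (u l) (openSquare a) := fun l =>
    (hu_cont l).mono (openSquare_subset_closedSquare a)
  have hb : ∀ l, ∃ R, ∀ z ∈ openSquare a, u l z ≤ R := fun l => by
    obtain ⟨M, hM⟩ := (isCompact_closedSquare a).exists_bound_of_continuousOn (hu_cont l)
    exact ⟨M, fun z hz =>
      (le_abs_self _).trans (hM z (openSquare_subset_closedSquare a hz))⟩
  have hseg : ∀ z ∈ closedSquare a, IsSegregated fun l => u l z := by
    intro z hz
    by_cases ho : z ∈ openSquare a
    · exact hu_min.1.isSegregated hc ho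
    · have hzb : z ∈ squareBoundary a := ⟨hz, ho⟩
      exact ⟨fun l => by simpa only [hu_boundary l z hzb] using hφ_nonneg l z hzb,
        fun l p hlp => by
          simpa only [hu_boundary _ z hzb] using hφ_segregated l p hlp z hzb⟩
  -- Passing to hats costs a factor m, so the strip contributes at most ε/4; m + 1 keeps the
  -- denominator positive for m = 0.
  obtain ⟨ρ, hρ, hstrip⟩ := exists_abs_sub_le_near_boundary ha hf hφ_nonneg hφ_segregated hu_cont
    hu_boundary (show 0 < ε / (4 * (m + 1)) by positivity)
  -- The corrector δ|z|² is at most 2a²δ = ε/4 on the square and its average exceeds it by δh². The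
  -- choice of η below makes twice the consistency error, 2mηh², smaller than that.
  set δ : ℝ := ε / (8 * a ^ 2) with hδ
  have hδ0 : 0 < δ := by positivity
  set η : ℝ := δ / (2 * (m + 1)) with hη
  have hη0 : 0 < η := by positivity
  obtain ⟨h₀, hh₀, hcons⟩ := exists_pos_forall (P := fun l h₀ => ∀ h, 0 ≤ h → h < h₀ →
      ∀ x ∈ Set.Icc ρ (a - ρ), ∀ y ∈ Set.Icc ρ (a - ρ),
      |1 / 4 * (u l (x - h, y) + u l (x + h, y) + u l (x, y - h) + u l (x, y + h)) - u l (x, y)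
        - h ^ 2 / 4 * lap (u l) (x, y)| ≤ η * h ^ 2) (fun l => by
    obtain ⟨h₀, hh₀, H⟩ := exists_abs_fivePoint_sub_le (hu_C2 l) hρ hη0
    exact ⟨h₀, hh₀, fun r _ hr h h1 h2 => H h h1 (h2.trans_le hr)⟩)
  obtain ⟨N₁, hN₁⟩ := exists_nat_gt (a / h₀)
  refine ⟨N₁ + 1, fun N hN U hU l i j hi hi' hj hj' => ?_⟩
  have hN0 : 0 < N := by omega
  have hNr : (0 : ℝ) < N := by exact_mod_cast hN0
  have hh : a / N < h₀ := by
    rw [div_lt_iff₀ hNr]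
    have h1 : a < N₁ * h₀ := (div_lt_iff₀ hh₀).1 hN₁
    have h2 : (N₁ : ℝ) ≤ N := by exact_mod_cast (show N₁ ≤ N by omega)
    nlinarith
  have hhpos : 0 < a / N := by positivity
  set I : ℤ → ℤ → Prop := fun i j => (1 ≤ i ∧ i ≤ N - 1 ∧ 1 ≤ j ∧ j ≤ N - 1) ∧
    (i : ℝ) * (a / N) ∈ Set.Icc ρ (a - ρ) ∧ (j : ℝ) * (a / N) ∈ Set.Icc ρ (a - ρ) with hI
  set W : Fin m → ℤ → ℤ → ℝ := fun l i j => u l (gridPoint a N i j) with hW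
  have hUseg := fun i j h1 h2 h3 h4 => hU.isSegregated ha hN0 hf hφ_nonneg hφ_segregated
    (i := i) (j := j) h1 h2 h3 h4
  have hWseg : ∀ i j : ℤ, 0 ≤ i → i ≤ N → 0 ≤ j → j ≤ N → IsSegregated fun l => W l i j :=
    fun i j h1 h2 h3 h4 => hseg _ (gridPoint_mem_closedSquare ha hN0 h1 h2 h3 h4)
  have hopen : ∀ i j, I i j → gridPoint a N i j ∈ openSquare a := fun i j h =>
    gridPoint_mem_openSquare ha hN0 h.1.1 h.1.2.1 h.1.2.2.1 h.1.2.2.2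
  have hlap : ∀ p i j, I i j → |neighbourAverage (W p) i j - W p i j
      - (a / N) ^ 2 / 4 * lap (u p) (gridPoint a N i j)| ≤ η * (a / N) ^ 2 := by
    intro p i j h
    have := hcons p (a / N) hhpos.le hh _ h.2.1 _ h.2.2
    simp only [hW, neighbourAverage, gridPoint]
    push_cast
    simpa only [sub_mul, add_mul, one_mul] using this
  have hhat : ∀ l i j, neighbourAverage (fun i j => hat (fun l => W l i j) l) i j
      - hat (fun l => W l i j) l = (neighbourAverage (W l) i j - W l i j)
        - ∑ p ∈ Finset.univ.erase l, (neighbourAverage (W p) i j - W p i j) := by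
    intro l i j
    rw [neighbourAverage_hat, hat, Finset.sum_sub_distrib]
    ring
  have hconst : ∀ l : Fin m, (m : ℝ) * (η * (a / N) ^ 2)
      = η * (a / N) ^ 2 + ∑ _p ∈ Finset.univ.erase l, η * (a / N) ^ 2 := by
    intro l
    rw [Finset.add_sum_erase _ (fun _ => η * (a / N) ^ 2) (Finset.mem_univ l)]
    simp
  have hη2 : 0 < η * (a / N) ^ 2 := by positivity
  have hsq : 0 ≤ (a / N) ^ 2 / 4 := by positivity
  have hWle : ∀ l i j, I i j → neighbourAverage (fun i j => hat (fun l => W l i j) l) i j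
      - hat (fun l => W l i j) l ≤ (a / N) ^ 2 / 4 * f l (gridPoint a N i j) (W l i j)
        + m * (η * (a / N) ^ 2) := by
    intro l i j h
    rw [hhat, hconst l]
    have h1 := (abs_le.1 (hlap l i j h)).2
    have h2 := mul_le_mul_of_nonneg_left
      (hu_min.lap_le hf hc hb hu_C2 l (hopen i j h)) hsq
    -- The other components enter the hat with a minus sign, so their discrete Laplacians are needed
    -- from below: where positive, through the equation and f ≥ 0; at a zero, because the average is
    -- nonnegative.
    have h3 : ∑ p ∈ Finset.univ.erase l, -(neighbourAverage (W p) i j - W p i j)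
        ≤ ∑ _p ∈ Finset.univ.erase l, η * (a / N) ^ 2 := by
      refine Finset.sum_le_sum fun p _ => ?_
      have hn := (hWseg i j (by linarith [h.1.1]) (by linarith [h.1.2.1])
        (by linarith [h.1.2.2.1]) (by linarith [h.1.2.2.2])).nonneg p
      rcases hn.lt_or_eq with hp | hp
      · have h4 := (abs_le.1 (hlap p i j h)).1
        rw [hu_min.lap_eq_of_pos hf hc hb hu_C2 (hopen i j h) hp] at h4
        have := mul_nonneg hsq ((hf p).nonneg (hopen i j h) hn)
        linarith
      · have h4 : neighbourAverage (fun _ _ => 0) i j ≤ neighbourAverage (W p) i j :=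
          neighbourAverage_le (N := N) (fun i j k1 k2 k3 k4 => (hWseg i j k1 k2 k3 k4).nonneg p)
            h.1.1 h.1.2.1 h.1.2.2.1 h.1.2.2.2
        have h5 : neighbourAverage (fun _ _ => 0) i j = 0 := by unfold neighbourAverage; ring
        linarith
    rw [Finset.sum_neg_distrib] at h3
    linarith
  have hWge : ∀ l i j, I i j → 0 < W l i j →
      (a / N) ^ 2 / 4 * f l (gridPoint a N i j) (W l i j) - m * (η * (a / N) ^ 2) ≤
      neighbourAverage (fun i j => hat (fun l => W l i j) l) i j - hat (fun l => W l i j) l := by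
    intro l i j h hp
    rw [hhat, hconst l]
    have h1 := (abs_le.1 (hlap l i j h)).1
    rw [hu_min.lap_eq_of_pos hf hc hb hu_C2 (hopen i j h) hp] at h1
    -- Near a point with `u l` positive the other components vanish identically, so only their
    -- consistency errors remain.
    have h3 : ∑ p ∈ Finset.univ.erase l, (neighbourAverage (W p) i j - W p i j)
        ≤ ∑ _p ∈ Finset.univ.erase l, η * (a / N) ^ 2 := by
      refine Finset.sum_le_sum fun p hpl => ?_
      have h4 := (abs_le.1 (hlap p i j h)).2
      rw [hu_min.lap_eq_zero_of_pos hc (Finset.ne_of_mem_erase hpl) (hopen i j h) hp] at h4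
      linarith
    linarith
  have hmη : (0 : ℝ) ≤ m * (η * (a / N) ^ 2) := by positivity
  have hnear : ∀ l, ∀ i j : ℤ, 0 ≤ i → i ≤ N → 0 ≤ j → j ≤ N → ¬ I i j →
      |hat (fun l => U l i j) l - hat (fun l => W l i j) l| ≤ m * (ε / (4 * (m + 1))) := by
    intro l i j h1 h2 h3 h4 hnot
    refine abs_hat_sub_hat_le (fun p => ?_) l
    by_cases hbd : i = 0 ∨ i = N ∨ j = 0 ∨ j = N
    · simp only [hW]
      rw [hU.boundary p i j h1 h2 h3 h4 hbd,
        hu_boundary p _ (gridPoint_mem_squareBoundary ha hN0 h1 h2 h3 h4 hbd), sub_self, abs_zero]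
      positivity
    · refine hstrip p N hN0 U hU i j h1 h2 h3 h4 fun hin => hnot ⟨?_, hin⟩
      omega
  have hcmp := abs_hat_sub_le (N := N) (V := U) (W := W)
    (F := fun l i j s => (a / N) ^ 2 / 4 * f l (gridPoint a N i j) s)
    (β := fun i j => δ * meshSqDist a N (0, 0) i j) (I := I) (e := m * (η * (a / N) ^ 2))
    (d := δ * (2 * a ^ 2)) (B := m * (ε / (4 * (m + 1)))) hUseg hWseg (fun i j h => h.1)
    (fun l i j h s hs t _ hst =>
      mul_le_mul_of_nonneg_left ((hf l).monotone _ (hopen i j h) s t hs hst) hsq)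
    (fun l i j h => (hU.neighbourAverage_meshHat_le ha hN0 hf hφ_nonneg hφ_segregated l
      h.1.1 h.1.2.1 h.1.2.2.1 h.1.2.2.2).trans (by linarith))
    (fun l i j h hp => by
      have h1 := hU.neighbourAverage_meshHat_of_pos l h.1.1 h.1.2.1 h.1.2.2.1 h.1.2.2.2 hp
      have h2 := (hUseg i j (by linarith [h.1.1]) (by linarith [h.1.2.1])
        (by linarith [h.1.2.2.1]) (by linarith [h.1.2.2.2])).hat_of_pos hp
      rw [h2]
      unfold meshHat at h1
      linarith)
    hWle hWge
    (fun i j _ => by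
      rw [neighbourAverage_const_mul, neighbourAverage_meshSqDist]
      have h1 : 2 * (m * η) < δ := by
        have : 2 * (m + 1) * η = δ := by
          rw [hη]
          field_simp
        linarith
      have h2 : 0 < (a / N) ^ 2 := by positivity
      nlinarith)
    (fun i j h1 h2 h3 h4 => by
      obtain ⟨x0, x1⟩ := mul_div_mem_Icc ha hN0 h1 h2
      obtain ⟨y0, y1⟩ := mul_div_mem_Icc ha hN0 h3 h4
      refine ⟨mul_nonneg hδ0.le (meshSqDist_nonneg _ _ _), ?_⟩
      unfold meshSqDist
      gcongr
      simp only [sub_zero]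
      nlinarith)
    (by positivity) hnear l i j hi hi' hj hj'
  have hfin := ((hUseg i j hi hi' hj hj').abs_sub_le (hWseg i j hi hi' hj hj') l).trans hcmp
  have e1 : δ * (2 * a ^ 2) = ε / 4 := by
    rw [hδ]
    field_simp
    ring
  have e2 : (m : ℝ) * (ε / (4 * (m + 1))) ≤ ε / 4 := by
    rw [← mul_div_assoc, div_le_div_iff₀ (by positivity) (by norm_num)]
    nlinarith
  rw [e1] at hfin
  simp only [hW] at hfin
  linarith
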